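/- Let $k,d$ be integers with $1\le d<k$. Let $X_k=SL_k(\mathbb R)/SL_k(\mathbb Z)$, identified with the space of unimodular lattices in $\mathbb R^k$ via $g\,SL_k(\mathbb Z)\mapsto g\mathbb Z^k$, and let $\mu$ be the normalized Haar measure on $X_k$, i.e. the Borel probability measure on $X_k$ invariant under the left action of $SL_k(\mathbb R)$ (such a measure exists). For a lattice $\Lambda\subset\mathbb R^k$, let $P^d(\Lambda)$ be the set of primitive ordered $d$-tuples of $\Lambda$, i.e. of those $(v_1,\dots,v_d)\in\Lambda^d$ that can be extended to a $\mathbb Z$-basis of $\Lambda$. Then for every complex-valued $\varphi\in L^1(\mathbb R^{kd})$ the series $$\widehat\varphi^{\,d}(\Lambda)=\sum_{(v_1,\dots,v_d)\in P^d(\Lambda)}\varphi(v_1,\dots,v_d)$$ converges absolutely for $\mu$-almost every $\Lambda\in X_k$, the function $\widehat\varphi^{\,d}$ is $\mu$-integrable, and $$\int_{X_k}\widehat\varphi^{\,d}\,d\mu=c_{k,d}\int_{\mathbb R^{kd}}\varphi\,dv_1\cdots dv_d,\qquad c_{k,d}=\frac1{\zeta(k)\,\zeta(k-1)\cdots\zeta(k-d+1)},$$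 where $\zeta$ is the Riemann zeta function. -/

import Mathlib

open MeasureTheory
open scoped MatrixGroups

noncomputable section

/-- `SL_k(ℤ)` as a subgroup of `SL_k(ℝ)`. -/
def integerSL (k : ℕ) : Subgroup SL(k, ℝ) :=
  (Matrix.SpecialLinearGroup.map (n := Fin k) (Int.castRingHom ℝ)).range

/-- The space `X_k = SL_k(ℝ) / SL_k(ℤ)` of left cosets, with its quotient topology and with
`SL_k(ℝ)` acting by left translation. -/
abbrev LatticeSpace (k : ℕ) : Type := SL(k, ℝ) ⧸ integerSL k

/-- `X_k` carries its Borel σ-algebra. -/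
instance instMeasurableSpaceLatticeSpace (k : ℕ) : MeasurableSpace (LatticeSpace k) :=
  borel (LatticeSpace k)

instance instBorelSpaceLatticeSpace (k : ℕ) : BorelSpace (LatticeSpace k) := ⟨rfl⟩

/-- The normalized Haar measure on `X_k`: a Borel probability measure that is invariant under the
left action of `SL_k(ℝ)`. -/
structure IsNormalizedHaar {k : ℕ} (μ : Measure (LatticeSpace k)) : Prop where
  isProbabilityMeasure : IsProbabilityMeasure μ
  smulInvariant : SMulInvariantMeasure SL(k, ℝ) (LatticeSpace k) μ

/-- The lattice `g ℤ^k ⊆ ℝ^k`: the integer span of the columns of `g`. -/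
def matrixLattice {k : ℕ} (g : SL(k, ℝ)) : Submodule ℤ (Fin k → ℝ) :=
  Submodule.span ℤ (Set.range (g : Matrix (Fin k) (Fin k) ℝ).col)

theorem matrixLattice_mul_le {k : ℕ} (g h : SL(k, ℝ)) (hh : h ∈ integerSL k) :
    matrixLattice (g * h) ≤ matrixLattice g := by
  obtain ⟨c, rfl⟩ := hh
  refine Submodule.span_le.2 ?_
  rintro _ ⟨j, rfl⟩
  have key : (↑(g * Matrix.SpecialLinearGroup.map (Int.castRingHom ℝ) c) :
      Matrix (Fin k) (Fin k) ℝ).col j =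
      ∑ i, (c : Matrix (Fin k) (Fin k) ℤ) i j • (g : Matrix (Fin k) (Fin k) ℝ).col i := by
    ext l
    simp [Matrix.col_apply, Matrix.mul_apply, Finset.sum_apply, mul_comm]
  rw [key]
  exact Submodule.sum_mem _ fun i _ =>
    Submodule.smul_mem _ _ (Submodule.subset_span ⟨i, rfl⟩)

theorem matrixLattice_eq_of_leftRel {k : ℕ} (g h : SL(k, ℝ))
    (hgh : QuotientGroup.leftRel (integerSL k) g h) : matrixLattice g = matrixLattice h := by
  rw [QuotientGroup.leftRel_apply] at hgh
  apply le_antisymm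
  · simpa using matrixLattice_mul_le h (g⁻¹ * h)⁻¹ (inv_mem hgh)
  · simpa using matrixLattice_mul_le g (g⁻¹ * h) hgh

/-- The unimodular lattice `g ℤ^k` represented by the coset `g SL_k(ℤ)`. -/
def LatticeSpace.lattice {k : ℕ} (x : LatticeSpace k) : Submodule ℤ (Fin k → ℝ) :=
  Quotient.lift matrixLattice matrixLattice_eq_of_leftRel x

/-- The set `P^d(Λ)` of ordered `d`-tuples of vectors of `Λ` that extend to a `ℤ`-basis of `Λ`
(a lattice in `ℝ^k`, so of rank `k`). -/
def primitiveTuples {k : ℕ} (d : ℕ) (L : Submodule ℤ (Fin k → ℝ)) : Set (Fin d → Fin k → ℝ) :=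
  {v | ∃ (b : Module.Basis (Fin k) ℤ L) (e : Fin d ↪ Fin k), ∀ i, (b (e i) : Fin k → ℝ) = v i}

/-- The sum of `φ` over the primitive `d`-tuples of the lattice `x`. -/
def primitiveSum {k d : ℕ} (φ : (Fin d → Fin k → ℝ) → ℂ) (x : LatticeSpace k) : ℂ :=
  ∑' v : primitiveTuples d x.lattice, φ v

end

/-! Write `v_m` for the covolume of `SL_m(ℤ)` in `SL_m(ℝ)`. The proof unfolds the mean value into a
ratio of covolumes, and then evaluates that ratio by counting lattice points.

Unfolding. For `d < k` the group `SL_k(ℤ)` acts transitively on integral primitive `d`-tuples, and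
the stabiliser of the first `d` standard vectors consists of the integral block matrices `(1 b; 0
γ)` with `γ ∈ SL_{k-d}(ℤ)`. Hence the integral over `X_k` of a sum over primitive tuples becomes an
integral over `SL_k(ℝ)` modulo this stabiliser. The first `d` columns run through `ℝ^{kd}`, the
block `b` contributes a unit torus, and `γ` contributes `v_{k-d}`. The mean value constant is
therefore `v_{k-d} / v_k` (`lintegral_primTsum`, `lintegral_latticeTsum`). Haar measure is realised
concretely, as Lebesgue measure on matrices with determinant in `[1, 2]` and density `det ^ (-n)`,
pushed to `SL_n(ℝ)` by dividing one column by the determinant. With this normalisation no further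
constants appear. A fundamental domain is replaced by a weight function that sums to one on each
coset of `SL_n(ℤ)` (`exists_isWeight`).

The constant. By Minkowski's theorem every unimodular lattice has a primitive vector in the unit
cube, so unfolding with `d = 1` bounds `v_k` by a multiple of `v_{k-1}`; all covolumes are thus
finite (`slCovolume_ne_top`). Every nonzero lattice vector is uniquely a positive multiple of a
primitive one, so the mean number of lattice points in `[-R, R]^k` is `1 + (v_{k-1} / v_k) ζ(k)
(2R)^k`. For each lattice the count is asymptotic to `(2R)^k`. Dominated convergence gives `v_k =
ζ(k) v_{k-1}` (`slCovolume_succ`), and iteration gives the product of zeta values.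

The formula passes from nonnegative to real and complex functions by linearity, and to a.e. classes
because a null set almost surely contains no primitive tuple (`ae_forall_notMem_of_null`). -/

noncomputable section

open Matrix Set
open scoped ENNReal

set_option linter.unusedSectionVars false

/-! ### Haar measure on `SL_n(ℝ)` from Lebesgue measure on matrices. -/

section HaarMeasure

variable {n : Type*} [Fintype n] [DecidableEq n]

instance instMeasurableSpaceSL : MeasurableSpace (SpecialLinearGroup n ℝ) := borel _

instance instBorelSpaceSL : BorelSpace (SpecialLinearGroup n ℝ) := ⟨rfl⟩

instance instSecondCountableTopologySL :
    SecondCountableTopology (SpecialLinearGroup n ℝ) :=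
  haveI : SecondCountableTopology (Matrix n n ℝ) :=
    inferInstanceAs (SecondCountableTopology (n → n → ℝ))
  TopologicalSpace.Subtype.secondCountableTopology {A : Matrix n n ℝ | A.det = 1}

instance instCountableSLInt : Countable (SpecialLinearGroup n ℤ) :=
  haveI : Countable (Matrix n n ℤ) := inferInstanceAs (Countable (n → n → ℤ))
  inferInstanceAs (Countable {A : Matrix n n ℤ // A.det = 1})

theorem measurable_sl_iff {α : Type*} [MeasurableSpace α] {f : α → SpecialLinearGroup n ℝ} :
    Measurable f ↔ ∀ i j, Measurable fun a => (f a : Matrix n n ℝ) i j := by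
  have h : (instMeasurableSpaceSL : MeasurableSpace (SpecialLinearGroup n ℝ)) =
      MeasurableSpace.comap (fun g : SpecialLinearGroup n ℝ => (fun i j => (g : Matrix n n ℝ) i j : n → n → ℝ))
        MeasurableSpace.pi := by
    rw [show (MeasurableSpace.pi : MeasurableSpace (n → n → ℝ)) = borel _ from
      BorelSpace.measurable_eq]
    exact borel_comap
  rw [h, measurable_comap_iff, measurable_pi_iff]
  simp only [measurable_pi_iff]
  rfl

theorem measurable_sl_apply (i j : n) :
    Measurable fun g : SpecialLinearGroup n ℝ => (g : Matrix n n ℝ) i j :=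
  measurable_sl_iff.1 measurable_id i j

/-- The element of `SL_n(ℝ)` given by a matrix of determinant one. -/
def slMk (M : Matrix n n ℝ) (h : M.det = 1) : SpecialLinearGroup n ℝ := ⟨M, h⟩

@[simp] theorem coe_slMk (M : Matrix n n ℝ) (h : M.det = 1) : (slMk M h : Matrix n n ℝ) = M := rfl

theorem sl_ext {g h : SpecialLinearGroup n ℝ} (H : (g : Matrix n n ℝ) = h) : g = h := Subtype.ext H

/-- The matrix whose columns are the given vectors. -/
def colMat (A : n → n → ℝ) : Matrix n n ℝ := (Matrix.of A)ᵀ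

@[simp] theorem colMat_apply (A : n → n → ℝ) (i j : n) : colMat A i j = A j i := rfl

theorem continuous_det_colMat : Continuous fun A : n → n → ℝ => (colMat A).det :=
  Continuous.matrix_det
    (continuous_pi fun i => continuous_pi fun j => by simp only [colMat_apply]; fun_prop)

theorem measurable_det_colMat : Measurable fun A : n → n → ℝ => (colMat A).det :=
  continuous_det_colMat.measurable

/-- Left multiplication of a tuple of columns by a matrix. -/
def mulCols {ι : Type*} (g : Matrix n n ℝ) (A : ι → n → ℝ) : ι → n → ℝ := fun j => g *ᵥ A j

theorem colMat_mulCols (g : Matrix n n ℝ) (A : n → n → ℝ) :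
    colMat (mulCols g A) = g * colMat A := by
  ext i j; simp [mulCols, Matrix.mul_apply, Matrix.mulVec, dotProduct]

theorem volume_preserving_mulVec (g : SpecialLinearGroup n ℝ) :
    MeasurePreserving (fun v : n → ℝ => (g : Matrix n n ℝ) *ᵥ v) volume volume := by
  refine ⟨by fun_prop, ?_⟩
  have h := Real.map_matrix_volume_pi_eq_smul_volume_pi (M := (g : Matrix n n ℝ)) (by simp)
  simp only [Matrix.SpecialLinearGroup.det_coe, inv_one, abs_one, ENNReal.ofReal_one, one_smul] at h
  exact h

theorem volume_preserving_mulCols {ι : Type*} [Fintype ι] (g : SpecialLinearGroup n ℝ) :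
    MeasurePreserving (mulCols (ι := ι) (g : Matrix n n ℝ)) volume volume :=
  volume_preserving_pi fun _ => volume_preserving_mulVec g

theorem volume_preserving_swap :
    MeasurePreserving (fun A : n → n → ℝ => fun i j => A j i) volume volume := by
  let T : (n → n → ℝ) →ₗ[ℝ] (n → n → ℝ) :=
    { toFun := fun A i j => A j i, map_add' := fun _ _ => rfl, map_smul' := fun _ _ => rfl }
  have hT : LinearMap.det T * LinearMap.det T = 1 := by
    rw [← LinearMap.det_comp]
    have : T ∘ₗ T = LinearMap.id := rfl
    rw [this, LinearMap.det_id]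
  have h0 : LinearMap.det T ≠ 0 := fun h => by simp [h] at hT
  have h1 : |(LinearMap.det T)⁻¹| = 1 := by
    rcases mul_self_eq_one_iff.1 hT with h | h <;> simp [h]
  refine ⟨?_, ?_⟩
  · exact measurable_pi_lambda _ fun i => measurable_pi_lambda _ fun j =>
      (measurable_pi_apply i).comp (measurable_pi_apply j)
  · have := Measure.map_linearMap_addHaar_eq_smul_addHaar (volume : Measure (n → n → ℝ)) h0
    rw [h1, ENNReal.ofReal_one, one_smul] at this
    exact this

/-- Right multiplication of a square tuple of columns by a matrix. -/
def rightMul (g : Matrix n n ℝ) (A : n → n → ℝ) : n → n → ℝ :=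
  fun i j => mulCols gᵀ (fun a b => A b a) j i

theorem colMat_rightMul (g : Matrix n n ℝ) (A : n → n → ℝ) :
    colMat (rightMul g A) = colMat A * g := by
  ext i j
  simp [rightMul, mulCols, Matrix.mul_apply, Matrix.mulVec, dotProduct, mul_comm]

theorem volume_preserving_rightMul (g : SpecialLinearGroup n ℝ) :
    MeasurePreserving (rightMul (g : Matrix n n ℝ)) volume volume := by
  have h := volume_preserving_mulCols (ι := n) g.transpose
  exact volume_preserving_swap.comp (h.comp volume_preserving_swap)

/-- A density on square matrices, supported where the determinant lies in `[1, 2]`. -/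
def detDensity (A : n → n → ℝ) : ℝ≥0∞ :=
  if (colMat A).det ∈ Icc (1 : ℝ) 2 then ENNReal.ofReal (((colMat A).det)⁻¹ ^ Fintype.card n) else 0

theorem measurable_detDensity : Measurable (detDensity (n := n)) := by
  refine Measurable.ite (measurable_det_colMat measurableSet_Icc) ?_ measurable_const
  exact ((measurable_det_colMat.inv).pow_const _).ennreal_ofReal

theorem detDensity_le_one (A : n → n → ℝ) : detDensity A ≤ 1 := by
  unfold detDensity
  split_ifs with h
  · rw [← ENNReal.ofReal_one]
    refine ENNReal.ofReal_le_ofReal (pow_le_one₀ ?_ (inv_le_one_of_one_le₀ h.1))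
    exact inv_nonneg.2 (zero_le_one.trans h.1)
  · exact zero_le

theorem detDensity_congr {A B : n → n → ℝ} (h : (colMat A).det = (colMat B).det) :
    detDensity A = detDensity B := by
  simp only [detDensity, h]

theorem detDensity_pos {A : n → n → ℝ} (h : (colMat A).det ∈ Icc (1 : ℝ) 2) :
    0 < detDensity A := by
  have : 0 < (colMat A).det := zero_lt_one.trans_le h.1
  rw [detDensity, if_pos h]
  positivity

theorem det_mem_of_detDensity_ne_zero {A : n → n → ℝ} (h : detDensity A ≠ 0) :
    (colMat A).det ∈ Icc (1 : ℝ) 2 := by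
  by_contra h'
  exact h (if_neg h')

/-- The measure on `SL_n(ℝ)` obtained from Lebesgue measure on matrices by normalising the
determinant by means of `N`. -/
def normMeasure (N : (n → n → ℝ) → SpecialLinearGroup n ℝ) : Measure (SpecialLinearGroup n ℝ) :=
  Measure.map N (volume.withDensity detDensity)

theorem lintegral_normMeasure {N : (n → n → ℝ) → SpecialLinearGroup n ℝ} (hN : Measurable N)
    {F : SpecialLinearGroup n ℝ → ℝ≥0∞} (hF : Measurable F) :
    ∫⁻ g, F g ∂normMeasure N = ∫⁻ A, detDensity A * F (N A) := by
  rw [normMeasure, lintegral_map hF hN]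
  exact lintegral_withDensity_eq_lintegral_mul _ measurable_detDensity (hF.comp hN)

/-- The density depends only on the determinant and vanishes unless it lies in `[1, 2]`, so a volume
and determinant preserving map `T` descends to a symmetry as soon as `N` intertwines it with `S` on
matrices of positive determinant. Both left and right invariance are instances. -/
theorem lintegral_normMeasure_comp {N : (n → n → ℝ) → SpecialLinearGroup n ℝ} (hN : Measurable N)
    {T : (n → n → ℝ) → n → n → ℝ} (hT : MeasurePreserving T volume volume)
    (hdet : ∀ A, (colMat (T A)).det = (colMat A).det)
    {S : SpecialLinearGroup n ℝ → SpecialLinearGroup n ℝ} (hS : Measurable S)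
    (hTS : ∀ A, 0 < (colMat A).det → N (T A) = S (N A)) :
    Measure.map S (normMeasure N) = normMeasure N := by
  refine Measure.ext_of_lintegral _ fun F hF => ?_
  rw [lintegral_map hF hS, lintegral_normMeasure hN (F := fun g => F (S g)) (hF.comp hS),
    lintegral_normMeasure hN hF, ← hT.lintegral_comp (f := fun A => detDensity A * F (N A))
      (measurable_detDensity.mul (hF.comp hN))]
  refine lintegral_congr fun A => ?_
  rw [detDensity_congr (hdet A)]
  by_cases h : detDensity A = 0
  · simp [h]
  · rw [hTS A (zero_lt_one.trans_le (det_mem_of_detDensity_ne_zero h).1)]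

theorem isMulLeftInvariant_normMeasure {N : (n → n → ℝ) → SpecialLinearGroup n ℝ}
    (hN : Measurable N)
    (hmul : ∀ (g : SpecialLinearGroup n ℝ) A, 0 < (colMat A).det → N (mulCols (g : Matrix n n ℝ) A) = g * N A) :
    (normMeasure N).IsMulLeftInvariant :=
  ⟨fun g => lintegral_normMeasure_comp hN (volume_preserving_mulCols g)
    (fun A => by rw [colMat_mulCols]; simp) (measurable_const_mul g) (hmul g)⟩

theorem isMulRightInvariant_normMeasure {N : (n → n → ℝ) → SpecialLinearGroup n ℝ}
    (hN : Measurable N)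
    (hmul : ∀ (g : SpecialLinearGroup n ℝ) A, 0 < (colMat A).det → N (rightMul (g : Matrix n n ℝ) A) = N A * g) :
    (normMeasure N).IsMulRightInvariant :=
  ⟨fun g => lintegral_normMeasure_comp hN (volume_preserving_rightMul g)
    (fun A => by rw [colMat_rightMul]; simp) (measurable_mul_const g) (hmul g)⟩

/-- The elements of `SL_n(ℝ)` whose entries are bounded by `R`. -/
def slBox (R : ℝ) : Set (SpecialLinearGroup n ℝ) := {g | ∀ i j, |(g : Matrix n n ℝ) i j| ≤ R}

theorem measurableSet_slBox (R : ℝ) : MeasurableSet (slBox (n := n) R) := by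
  simp only [slBox, ofPred_forall]
  refine MeasurableSet.iInter fun i => MeasurableSet.iInter fun j => ?_
  exact (measurable_sl_apply i j).abs measurableSet_Iic

theorem iUnion_slBox : ⋃ m : ℕ, slBox (n := n) m = univ := by
  refine eq_univ_of_forall fun g => mem_iUnion.2 ?_
  obtain ⟨m, hm⟩ := exists_nat_ge (∑ i, ∑ j, |(g : Matrix n n ℝ) i j|)
  refine ⟨m, fun i j => le_trans ?_ hm⟩
  calc |(g : Matrix n n ℝ) i j| ≤ ∑ j, |(g : Matrix n n ℝ) i j| :=
        Finset.single_le_sum (f := fun j => |(g : Matrix n n ℝ) i j|)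
          (fun _ _ => abs_nonneg _) (Finset.mem_univ j)
    _ ≤ _ := Finset.single_le_sum (f := fun i => ∑ j, |(g : Matrix n n ℝ) i j|)
          (fun _ _ => Finset.sum_nonneg fun _ _ => abs_nonneg _) (Finset.mem_univ i)

/-- If normalising shrinks entries by at most a factor 2, the part of the preimage of a box that
carries mass is bounded. This yields σ-finiteness and the sets of finite measure needed to compare
invariant measures. -/
theorem normMeasure_slBox_lt_top {N : (n → n → ℝ) → SpecialLinearGroup n ℝ} (hN : Measurable N)
    (hb : ∀ A, (colMat A).det ∈ Icc (1 : ℝ) 2 → ∀ i j, |A j i| ≤ 2 * |(N A : Matrix n n ℝ) i j|)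
    (R : ℝ) : normMeasure N (slBox R) < ∞ := by
  rw [normMeasure, Measure.map_apply hN (measurableSet_slBox R),
    withDensity_apply _ (hN (measurableSet_slBox R))]
  calc ∫⁻ A in N ⁻¹' slBox R, detDensity A
      ≤ ∫⁻ A in N ⁻¹' slBox R, (Metric.closedBall (0 : n → n → ℝ) |2 * R|).indicator 1 A := by
        refine setLIntegral_mono' (hN (measurableSet_slBox R)) fun A hA => ?_
        by_cases h : detDensity A = 0
        · simp [h]
        · rw [indicator_of_mem]
          · exact detDensity_le_one A
          · rw [mem_closedBall_zero_iff, pi_norm_le_iff_of_nonneg (abs_nonneg _)]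
            intro j
            rw [pi_norm_le_iff_of_nonneg (abs_nonneg _)]
            intro i
            rw [Real.norm_eq_abs]
            refine (hb A (det_mem_of_detDensity_ne_zero h) i j).trans (le_trans ?_ (le_abs_self _))
            exact mul_le_mul_of_nonneg_left (hA i j) zero_le_two
    _ ≤ ∫⁻ A, (Metric.closedBall (0 : n → n → ℝ) |2 * R|).indicator 1 A :=
        setLIntegral_le_lintegral _ _
    _ = volume (Metric.closedBall (0 : n → n → ℝ) |2 * R|) :=
        lintegral_indicator_one Metric.isClosed_closedBall.measurableSet
    _ < ∞ := measure_closedBall_lt_top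

theorem sigmaFinite_of_slBox {m : Measure (SpecialLinearGroup n ℝ)}
    (h : ∀ R : ℝ, m (slBox R) < ∞) : SigmaFinite m :=
  ⟨⟨{ set := fun i : ℕ => slBox i
      set_mem := fun _ => trivial
      finite := fun i => h i
      spanning := iUnion_slBox }⟩⟩

theorem exists_det_mem_Ioo [Nonempty n] : ∃ A : n → n → ℝ, (colMat A).det ∈ Ioo (1 : ℝ) 2 := by
  obtain ⟨j⟩ := ‹Nonempty n›
  refine ⟨fun i => (diagonal (Function.update (1 : n → ℝ) j (3 / 2))) i, ?_⟩
  have : colMat (fun i => (diagonal (Function.update (1 : n → ℝ) j (3 / 2))) i) =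
      (diagonal (Function.update (1 : n → ℝ) j (3 / 2)))ᵀ := rfl
  rw [this, det_transpose, det_diagonal, Finset.prod_update_of_mem (Finset.mem_univ j)]
  simp only [Pi.one_apply, Finset.prod_const_one, mul_one]
  norm_num

theorem normMeasure_ne_zero [Nonempty n] {N : (n → n → ℝ) → SpecialLinearGroup n ℝ}
    (hN : Measurable N) : normMeasure N ≠ 0 := by
  intro h
  have h1 : ∫⁻ _, 1 ∂normMeasure N = 0 := by simp [h]
  rw [lintegral_normMeasure hN measurable_const] at h1
  simp only [mul_one] at h1
  rw [lintegral_eq_zero_iff measurable_detDensity] at h1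
  have hopen : IsOpen {A : n → n → ℝ | (colMat A).det ∈ Ioo (1 : ℝ) 2} :=
    isOpen_Ioo.preimage continuous_det_colMat
  refine (hopen.measure_pos volume exists_det_mem_Ioo).ne' ?_
  refine measure_mono_null (fun A hA => ?_) h1
  exact (detDensity_pos (Ioo_subset_Icc_self hA)).ne'

theorem exists_slBox_ne_zero {m : Measure (SpecialLinearGroup n ℝ)} (hm : m ≠ 0) :
    ∃ i : ℕ, m (slBox i) ≠ 0 := by
  by_contra! h
  refine hm (Measure.measure_univ_eq_zero.1 ?_)
  rw [← iUnion_slBox, measure_iUnion_null_iff]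
  exact h

/-- Normalisation of the determinant by rescaling the column `j`. -/
def normalizeCol (j : n) (A : n → n → ℝ) : SpecialLinearGroup n ℝ :=
  if h : 0 < (colMat A).det then
    slMk (colMat A * diagonal (Function.update (1 : n → ℝ) j (colMat A).det⁻¹)) <| by
      rw [det_mul, det_diagonal, Finset.prod_update_of_mem (Finset.mem_univ j)]
      simp [h.ne']
  else 1

theorem coe_normalizeCol {j : n} {A : n → n → ℝ} (h : 0 < (colMat A).det) :
    (normalizeCol j A : Matrix n n ℝ) =
      colMat A * diagonal (Function.update (1 : n → ℝ) j (colMat A).det⁻¹) := by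
  rw [normalizeCol, dif_pos h, coe_slMk]

theorem measurable_sl_of_det_pos {α : Type*} [MeasurableSpace α] {f : α → SpecialLinearGroup n ℝ}
    {p : α → Prop} (hp : MeasurableSet {a | p a}) {M : α → Matrix n n ℝ}
    (hM : ∀ i j, Measurable fun a => M a i j)
    (hf : ∀ a, p a → (f a : Matrix n n ℝ) = M a) (hf' : ∀ a, ¬ p a → f a = 1) : Measurable f := by
  classical
  refine measurable_sl_iff.2 fun i j => ?_
  have : (fun a => (f a : Matrix n n ℝ) i j) =
      fun a => if p a then M a i j else (1 : Matrix n n ℝ) i j := by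
    funext a
    split_ifs with h
    · rw [hf a h]
    · rw [hf' a h]; rfl
  rw [this]
  exact Measurable.ite hp (hM i j) measurable_const

theorem measurable_normalizeCol (j : n) : Measurable (normalizeCol j) := by
  refine measurable_sl_of_det_pos (p := fun A => 0 < (colMat A).det)
    (measurable_det_colMat measurableSet_Ioi)
    (M := fun A => colMat A * diagonal (Function.update (1 : n → ℝ) j (colMat A).det⁻¹)) ?_
    (fun _ h => coe_normalizeCol h) (fun _ h => dif_neg h)
  intro i l
  simp only [mul_diagonal, colMat_apply]
  refine Measurable.mul (by fun_prop) ?_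
  by_cases h : l = j
  · subst h
    simp only [Function.update_self]
    exact measurable_det_colMat.inv
  · simp only [Function.update_of_ne h]
    exact measurable_const

theorem normalizeCol_mulCols (j : n) (g : SpecialLinearGroup n ℝ) (A : n → n → ℝ)
    (h : 0 < (colMat A).det) : normalizeCol j (mulCols (g : Matrix n n ℝ) A) = g * normalizeCol j A := by
  have hd : (colMat (mulCols (g : Matrix n n ℝ) A)).det = (colMat A).det := by rw [colMat_mulCols]; simp
  apply sl_ext
  rw [coe_normalizeCol (hd ▸ h), Matrix.SpecialLinearGroup.coe_mul, coe_normalizeCol h, hd,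
    colMat_mulCols, Matrix.mul_assoc]

/-- Normalisation of the determinant by a scalar. -/
def normalizeScalar (A : n → n → ℝ) : SpecialLinearGroup n ℝ :=
  if h : 0 < (colMat A).det then
    slMk (((colMat A).det ^ (-(Fintype.card n : ℝ)⁻¹)) • colMat A) <| by
      rcases isEmpty_or_nonempty n with hn | hn
      · simp
      · rw [det_smul, ← Real.rpow_natCast, ← Real.rpow_mul h.le, neg_mul,
          inv_mul_cancel₀ (by simp), Real.rpow_neg_one, inv_mul_cancel₀ h.ne']
  else 1

theorem coe_normalizeScalar {A : n → n → ℝ} (h : 0 < (colMat A).det) :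
    (normalizeScalar A : Matrix n n ℝ) =
      ((colMat A).det ^ (-(Fintype.card n : ℝ)⁻¹)) • colMat A := by
  rw [normalizeScalar, dif_pos h, coe_slMk]

theorem measurable_normalizeScalar : Measurable (normalizeScalar (n := n)) := by
  refine measurable_sl_of_det_pos (p := fun A => 0 < (colMat A).det)
    (measurable_det_colMat measurableSet_Ioi)
    (M := fun A => ((colMat A).det ^ (-(Fintype.card n : ℝ)⁻¹)) • colMat A) ?_
    (fun A h => coe_normalizeScalar h) (fun _ h => dif_neg h)
  intro i l
  simp only [Matrix.smul_apply, smul_eq_mul, colMat_apply]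
  exact (measurable_det_colMat.pow_const _).mul (by fun_prop)

theorem normalizeScalar_mulCols (g : SpecialLinearGroup n ℝ) (A : n → n → ℝ)
    (h : 0 < (colMat A).det) : normalizeScalar (mulCols (g : Matrix n n ℝ) A) = g * normalizeScalar A := by
  have hd : (colMat (mulCols (g : Matrix n n ℝ) A)).det = (colMat A).det := by rw [colMat_mulCols]; simp
  apply sl_ext
  rw [coe_normalizeScalar (hd ▸ h), Matrix.SpecialLinearGroup.coe_mul, coe_normalizeScalar h, hd,
    colMat_mulCols, Matrix.mul_smul]

theorem normalizeScalar_rightMul (g : SpecialLinearGroup n ℝ) (A : n → n → ℝ)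
    (h : 0 < (colMat A).det) : normalizeScalar (rightMul (g : Matrix n n ℝ) A) = normalizeScalar A * g := by
  have hd : (colMat (rightMul (g : Matrix n n ℝ) A)).det = (colMat A).det := by rw [colMat_rightMul]; simp
  apply sl_ext
  rw [coe_normalizeScalar (hd ▸ h), Matrix.SpecialLinearGroup.coe_mul, coe_normalizeScalar h, hd,
    colMat_rightMul, Matrix.smul_mul]

theorem abs_le_normalizeCol (j : n) (A : n → n → ℝ) (h : (colMat A).det ∈ Icc (1 : ℝ) 2)
    (i l : n) : |A l i| ≤ 2 * |(normalizeCol j A : Matrix n n ℝ) i l| := by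
  have h0 : 0 < (colMat A).det := zero_lt_one.trans_le h.1
  rw [coe_normalizeCol h0, mul_diagonal, colMat_apply, abs_mul]
  have hx : 1 ≤ 2 * |Function.update (1 : n → ℝ) j (colMat A).det⁻¹ l| := by
    by_cases hl : l = j
    · subst hl
      rw [Function.update_self, abs_of_pos (inv_pos.2 h0), ← div_eq_mul_inv, one_le_div h0]
      exact h.2
    · simp [Function.update_of_ne hl]
  nlinarith [abs_nonneg (A l i)]

theorem abs_le_normalizeScalar (A : n → n → ℝ) (h : (colMat A).det ∈ Icc (1 : ℝ) 2)
    (i l : n) : |A l i| ≤ 2 * |(normalizeScalar A : Matrix n n ℝ) i l| := by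
  have h0 : 0 < (colMat A).det := zero_lt_one.trans_le h.1
  rw [coe_normalizeScalar h0, Matrix.smul_apply, smul_eq_mul, colMat_apply, abs_mul,
    abs_of_pos (Real.rpow_pos_of_pos h0 _)]
  have hx : 1 ≤ 2 * (colMat A).det ^ (-(Fintype.card n : ℝ)⁻¹) := by
    have hn : (Fintype.card n : ℝ)⁻¹ ≤ 1 := by
      rcases Nat.eq_zero_or_pos (Fintype.card n) with hc | hc
      · simp [hc]
      · exact inv_le_one_of_one_le₀ (by exact_mod_cast hc)
    have h2 : (colMat A).det ^ (-1 : ℝ) ≤ (colMat A).det ^ (-(Fintype.card n : ℝ)⁻¹) :=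
      Real.rpow_le_rpow_of_exponent_le h.1 (by linarith)
    rw [Real.rpow_neg_one] at h2
    have h3 : (2 : ℝ)⁻¹ ≤ (colMat A).det⁻¹ := inv_anti₀ h0 h.2
    linarith
  nlinarith [abs_nonneg (A l i)]

/-- A Haar measure on `SL_n(ℝ)`. -/
def slHaar (j : n) : Measure (SpecialLinearGroup n ℝ) := normMeasure (normalizeCol j)

instance sigmaFinite_slHaar (j : n) : SigmaFinite (slHaar j) :=
  sigmaFinite_of_slBox
    (normMeasure_slBox_lt_top (measurable_normalizeCol j) (abs_le_normalizeCol j))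

instance isMulLeftInvariant_slHaar (j : n) : (slHaar j).IsMulLeftInvariant :=
  isMulLeftInvariant_normMeasure (measurable_normalizeCol j) (normalizeCol_mulCols j)

theorem slHaar_slBox_ne_top (j : n) (R : ℝ) : slHaar j (slBox R) ≠ ∞ :=
  (normMeasure_slBox_lt_top (measurable_normalizeCol j) (abs_le_normalizeCol j) R).ne

theorem slHaar_ne_zero (j : n) : slHaar j ≠ 0 :=
  haveI : Nonempty n := ⟨j⟩
  normMeasure_ne_zero (measurable_normalizeCol j)

/-- Left invariant measures on `SL_n(ℝ)` are proportional. -/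
theorem exists_eq_smul_of_slBox {m m' : Measure (SpecialLinearGroup n ℝ)} [SigmaFinite m]
    [SigmaFinite m'] [m.IsMulLeftInvariant] [m'.IsMulLeftInvariant] (h0 : m ≠ 0)
    (ht : ∀ R : ℝ, m (slBox R) ≠ ∞) : ∃ c : ℝ≥0∞, m' = c • m := by
  obtain ⟨i, hi⟩ := exists_slBox_ne_zero h0
  exact ⟨_, measure_eq_div_smul m' m hi (ht i)⟩

/-- Unimodularity: column normalisation commutes only with left multiplication, but scalar
normalisation commutes with both sides. By uniqueness of left-invariant measures `slHaar j` is a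
multiple of the resulting bi-invariant measure. -/
instance isMulRightInvariant_slHaar (j : n) : (slHaar j).IsMulRightInvariant := by
  have : Nonempty n := ⟨j⟩
  have hlt := normMeasure_slBox_lt_top (n := n) measurable_normalizeScalar abs_le_normalizeScalar
  have : SigmaFinite (normMeasure (normalizeScalar (n := n))) := sigmaFinite_of_slBox hlt
  have : (normMeasure (normalizeScalar (n := n))).IsMulLeftInvariant :=
    isMulLeftInvariant_normMeasure measurable_normalizeScalar normalizeScalar_mulCols
  have : (normMeasure (normalizeScalar (n := n))).IsMulRightInvariant :=
    isMulRightInvariant_normMeasure measurable_normalizeScalar normalizeScalar_rightMul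
  obtain ⟨c, hc⟩ := exists_eq_smul_of_slBox (m := normMeasure (normalizeScalar (n := n)))
    (m' := slHaar j) (normMeasure_ne_zero measurable_normalizeScalar) fun R => (hlt R).ne
  refine ⟨fun g => ?_⟩
  rw [hc, Measure.map_smul, map_mul_right_eq_self]

theorem lintegral_slHaar (j : n) {F : SpecialLinearGroup n ℝ → ℝ≥0∞} (hF : Measurable F) :
    ∫⁻ g, F g ∂slHaar j = ∫⁻ A, detDensity A * F (normalizeCol j A) :=
  lintegral_normMeasure (measurable_normalizeCol j) hF

end HaarMeasure

/-! ### Weights replacing a fundamental domain for `SL_n(ℤ)`. -/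

section Weights

variable {n : Type*} [Fintype n] [DecidableEq n]

/-- The inclusion of `SL_n(ℤ)` into `SL_n(ℝ)`. -/
def slInt : SpecialLinearGroup n ℤ →* SpecialLinearGroup n ℝ :=
  Matrix.SpecialLinearGroup.map (Int.castRingHom ℝ)

@[simp] theorem slInt_apply (γ : SpecialLinearGroup n ℤ) (i j : n) :
    (slInt γ : Matrix n n ℝ) i j = ((γ : Matrix n n ℤ) i j : ℝ) := rfl

theorem le_tsum_slInt (w : SpecialLinearGroup n ℝ → ℝ≥0∞) (g : SpecialLinearGroup n ℝ) :
    w g ≤ ∑' γ, w (g * slInt γ) := by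
  have h := ENNReal.le_tsum (f := fun γ => w (g * slInt γ)) 1
  rwa [map_one, mul_one] at h

/-- A positive measurable function on `SL_n(ℝ)` whose sum over each coset of `SL_n(ℤ)` is one; it
plays the role of the indicator function of a fundamental domain. -/
structure IsWeight (w : SpecialLinearGroup n ℝ → ℝ≥0∞) : Prop where
  measurable : Measurable w
  pos : ∀ g, 0 < w g
  tsum_eq : ∀ g, ∑' γ, w (g * slInt γ) = 1

theorem IsWeight.le_one {w : SpecialLinearGroup n ℝ → ℝ≥0∞} (hw : IsWeight w)
    (g : SpecialLinearGroup n ℝ) : w g ≤ 1 := by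
  rw [← hw.tsum_eq g]
  exact le_tsum_slInt w g

theorem continuous_sl_apply (i j : n) :
    Continuous fun g : SpecialLinearGroup n ℝ => (g : Matrix n n ℝ) i j :=
  (continuous_apply_apply i j).comp continuous_subtype_val

/-- Discreteness of `SL_n(ℤ)`: an integral matrix whose entries differ from those of the identity by
less than 1 is the identity, and `a⁻¹ * b` is close to the identity for `a, b` in a small
neighbourhood of it. -/
theorem exists_isOpen_small : ∃ V : Set (SpecialLinearGroup n ℝ), IsOpen V ∧ 1 ∈ V ∧
    ∀ γ : SpecialLinearGroup n ℤ, ∀ a ∈ V, a * slInt γ ∈ V → γ = 1 := by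
  let W : Set (SpecialLinearGroup n ℝ) :=
    {h | ∀ i j, |(h : Matrix n n ℝ) i j - (1 : Matrix n n ℝ) i j| < 1}
  have hW : IsOpen W := by
    simp only [W, ofPred_forall]
    refine isOpen_iInter_of_finite fun i => isOpen_iInter_of_finite fun j => ?_
    exact isOpen_lt ((continuous_sl_apply i j).sub continuous_const).abs continuous_const
  have hc : Continuous fun p : SpecialLinearGroup n ℝ × SpecialLinearGroup n ℝ => p.1⁻¹ * p.2 := by
    fun_prop
  have h1 : (fun p : SpecialLinearGroup n ℝ × SpecialLinearGroup n ℝ => p.1⁻¹ * p.2) ⁻¹' W ∈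
      nhds ((1, 1) : SpecialLinearGroup n ℝ × SpecialLinearGroup n ℝ) := by
    refine (hW.preimage hc).mem_nhds ?_
    simp [W]
  rw [nhds_prod_eq, Filter.mem_prod_same_iff] at h1
  obtain ⟨U, hU, hUW⟩ := h1
  refine ⟨interior U, isOpen_interior, mem_interior_iff_mem_nhds.2 hU, fun γ a ha ha' => ?_⟩
  have h2 := hUW (show (a, a * slInt γ) ∈ U ×ˢ U from ⟨interior_subset ha, interior_subset ha'⟩)
  simp only [mem_preimage, inv_mul_cancel_left] at h2
  apply Matrix.SpecialLinearGroup.ext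
  intro i j
  have h3 := h2 i j
  have h4 : (1 : Matrix n n ℝ) i j = (((1 : Matrix n n ℤ) i j : ℤ) : ℝ) := by
    by_cases h : i = j <;> simp [Matrix.one_apply, h]
  rw [slInt_apply, h4] at h3
  have h5 : |(γ : Matrix n n ℤ) i j - (1 : Matrix n n ℤ) i j| < 1 := by exact_mod_cast h3
  rw [Int.abs_lt_one_iff] at h5
  rw [Matrix.SpecialLinearGroup.coe_one]
  linarith

/-- Countably many translates of the small neighbourhood cover the group, and each meets a coset of
`SL_n(ℤ)` at most once. The sum `u` of their indicators with weights `2⁻ⁱ` is positive, and its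
coset sum `S` is at most 2; then `u / S` is a weight. -/
theorem exists_isWeight : ∃ w : SpecialLinearGroup n ℝ → ℝ≥0∞, IsWeight w := by
  classical
  obtain ⟨V, hVo, hV1, hV⟩ := exists_isOpen_small (n := n)
  let f : SpecialLinearGroup n ℝ → Set (SpecialLinearGroup n ℝ) := fun x => {y | x⁻¹ * y ∈ V}
  have hfo : ∀ x, IsOpen (f x) := fun x => hVo.preimage (continuous_const.mul continuous_id)
  obtain ⟨s, hs, hsu⟩ := TopologicalSpace.countable_cover_nhds (f := f)
    fun x => (hfo x).mem_nhds (by simpa [f] using hV1)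
  have hsne : s.Nonempty := by
    rw [nonempty_iff_ne_empty]
    rintro rfl
    simp only [mem_empty_iff_false, iUnion_of_empty, iUnion_empty] at hsu
    exact notMem_empty (1 : SpecialLinearGroup n ℝ) (hsu ▸ mem_univ _)
  obtain ⟨x, rfl⟩ := hs.exists_eq_range hsne
  have hcover : ∀ g, ∃ i : ℕ, g ∈ f (x i) := by
    intro g
    have : g ∈ ⋃ y ∈ range x, f y := hsu ▸ mem_univ g
    simpa using this
  let u : SpecialLinearGroup n ℝ → ℝ≥0∞ := fun g =>
    ∑' i : ℕ, (2 : ℝ≥0∞)⁻¹ ^ i * (f (x i)).indicator 1 g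
  have hum : Measurable u := Measurable.tsum fun i =>
    (measurable_one.indicator (hfo _).measurableSet).const_mul _
  have hupos : ∀ g, 0 < u g := by
    intro g
    obtain ⟨i, hi⟩ := hcover g
    refine lt_of_lt_of_le ?_ (ENNReal.le_tsum i)
    rw [indicator_of_mem hi, Pi.one_apply, mul_one]
    exact ENNReal.pow_pos (by simp) i
  let S : SpecialLinearGroup n ℝ → ℝ≥0∞ := fun g => ∑' γ, u (g * slInt γ)
  have hSm : Measurable S := Measurable.tsum fun γ => hum.comp (measurable_mul_const _)
  have huS : ∀ g, u g ≤ S g := le_tsum_slInt u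
  have hone : ∀ i g, ∑' γ, (f (x i)).indicator (1 : SpecialLinearGroup n ℝ → ℝ≥0∞) (g * slInt γ)
      ≤ 1 := by
    intro i g
    by_cases h : ∃ γ₀, g * slInt γ₀ ∈ f (x i)
    · obtain ⟨γ₀, h0⟩ := h
      rw [tsum_eq_single γ₀]
      · rw [indicator_of_mem h0]; rfl
      · intro γ hγ
        refine indicator_of_notMem (fun hmem => hγ ?_) _
        have h2 := hV (γ₀⁻¹ * γ) _ h0 (by
          have : (x i)⁻¹ * (g * slInt γ₀) * slInt (γ₀⁻¹ * γ) = (x i)⁻¹ * (g * slInt γ) := by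
            rw [map_mul, map_inv]; group
          rw [this]; exact hmem)
        exact (inv_mul_eq_one.1 h2).symm
    · push Not at h
      simp [indicator_of_notMem (h _)]
  have hSle : ∀ g, S g ≤ 2 := by
    intro g
    simp only [S, u]
    rw [ENNReal.tsum_comm]
    simp only [ENNReal.tsum_mul_left]
    calc ∑' i : ℕ, (2 : ℝ≥0∞)⁻¹ ^ i *
          ∑' γ, (f (x i)).indicator (1 : SpecialLinearGroup n ℝ → ℝ≥0∞) (g * slInt γ)
        ≤ ∑' i : ℕ, (2 : ℝ≥0∞)⁻¹ ^ i := ENNReal.tsum_le_tsum fun i =>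
          (mul_le_mul_right (hone i g) _).trans (mul_one _).le
      _ = 2 := by rw [ENNReal.tsum_geometric]; simp
  have hSinv : ∀ g γ, S (g * slInt γ) = S g := by
    intro g γ
    simp only [S]
    rw [← (Equiv.mulLeft γ).tsum_eq (fun γ' => u (g * slInt γ'))]
    simp [mul_assoc]
  have hS0 : ∀ g, S g ≠ 0 := fun g => ((hupos g).trans_le (huS g)).ne'
  have hSt : ∀ g, S g ≠ ∞ := fun g => ((hSle g).trans_lt (by simp)).ne
  refine ⟨fun g => u g / S g, hum.div hSm, fun g => ENNReal.div_pos (hupos g).ne' (hSt g),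
    fun g => ?_⟩
  simp only [hSinv, div_eq_mul_inv, ENNReal.tsum_mul_right]
  exact ENNReal.mul_inv_cancel (hS0 g) (hSt g)

/-- A chosen weight on `SL_n(ℝ)`. -/
def slWeight : SpecialLinearGroup n ℝ → ℝ≥0∞ := exists_isWeight.choose

theorem isWeight_slWeight : IsWeight (slWeight (n := n)) := exists_isWeight.choose_spec

/-- Right invariance moves the translation by `γ` from `F` to the weight, where the sum over `γ` is
one. -/
theorem IsWeight.lintegral_eq {w : SpecialLinearGroup n ℝ → ℝ≥0∞} (hw : IsWeight w)
    (m : Measure (SpecialLinearGroup n ℝ)) [m.IsMulRightInvariant]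
    {F : SpecialLinearGroup n ℝ → ℝ≥0∞} (hF : Measurable F) :
    ∫⁻ g, w g * ∑' γ, F (g * slInt γ) ∂m = ∫⁻ g, F g ∂m := by
  calc ∫⁻ g, w g * ∑' γ, F (g * slInt γ) ∂m
      = ∫⁻ g, ∑' γ, w g * F (g * slInt γ) ∂m := by simp only [ENNReal.tsum_mul_left]
    _ = ∑' γ, ∫⁻ g, w g * F (g * slInt γ) ∂m := lintegral_tsum fun γ =>
        (hw.measurable.mul (hF.comp (measurable_mul_const _))).aemeasurable
    _ = ∑' γ, ∫⁻ g, w (g * slInt γ⁻¹) * F g ∂m := by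
        refine tsum_congr fun γ => ?_
        rw [← lintegral_mul_right_eq_self (fun g => w (g * slInt γ⁻¹) * F g) (slInt γ)]
        simp [mul_assoc]
    _ = ∫⁻ g, ∑' γ, w (g * slInt γ⁻¹) * F g ∂m := (lintegral_tsum fun γ =>
        ((hw.measurable.comp (measurable_mul_const _)).mul hF).aemeasurable).symm
    _ = ∫⁻ g, F g ∂m := by
        refine lintegral_congr fun g => ?_
        rw [ENNReal.tsum_mul_right, show ∑' γ, w (g * slInt γ⁻¹) = ∑' γ, w (g * slInt γ) from
          (Equiv.inv _).tsum_eq (fun γ => w (g * slInt γ)), hw.tsum_eq,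
          one_mul]

/-- Two weights give the same integral to a function invariant under `SL_n(ℤ)`. -/
theorem IsWeight.lintegral_congr {w w' : SpecialLinearGroup n ℝ → ℝ≥0∞} (hw : IsWeight w)
    (hw' : IsWeight w') (m : Measure (SpecialLinearGroup n ℝ)) [m.IsMulRightInvariant]
    {H : SpecialLinearGroup n ℝ → ℝ≥0∞} (hH : Measurable H)
    (hinv : ∀ g γ, H (g * slInt γ) = H g) :
    ∫⁻ g, w g * H g ∂m = ∫⁻ g, w' g * H g ∂m := by
  rw [← hw.lintegral_eq m (F := fun g => w' g * H g) (hw'.measurable.mul hH)]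
  refine MeasureTheory.lintegral_congr fun g => ?_
  simp only [hinv, ENNReal.tsum_mul_right, hw'.tsum_eq, one_mul]

/-- The covolume of `SL_n(ℤ)` in `SL_n(ℝ)`. -/
def slCovolume (j : n) : ℝ≥0∞ := ∫⁻ g, slWeight g ∂slHaar j

theorem slCovolume_ne_zero (j : n) : slCovolume j ≠ 0 := by
  intro h
  rw [slCovolume, lintegral_eq_zero_iff isWeight_slWeight.measurable] at h
  refine slHaar_ne_zero j (Measure.measure_univ_eq_zero.1 (measure_mono_null (fun g _ => ?_) h))
  exact (isWeight_slWeight.pos g).ne'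

end Weights

/-! ### Singular matrices form a null set. -/

section SingularMatrices

variable {n : Type*} [Fintype n] [DecidableEq n]

/-- For fixed `A`, `det (A + t I)` is a monic polynomial in `t`, with finitely many zeros. By Fubini
some translate of the singular set is null, hence so is the set itself. -/
theorem volume_det_eq_zero [Nonempty n] : volume {A : n → n → ℝ | (colMat A).det = 0} = 0 := by
  let I : n → n → ℝ := fun i => (1 : Matrix n n ℝ) i
  have hI : ∀ (A : n → n → ℝ) (t : ℝ), colMat (A + t • I) = scalar n t - -colMat A := by
    intro A t
    ext i j
    by_cases h : i = j
    · subst h; simp [I, add_comm]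
    · simp [I, h, Ne.symm h, scalar_apply]
  let S : Set (ℝ × (n → n → ℝ)) := {p | (colMat (p.2 + p.1 • I)).det = 0}
  have hS : MeasurableSet S := by
    refine measurableSet_eq_fun (measurable_det_colMat.comp ?_) measurable_const
    fun_prop
  have hS' : MeasurableSet (Prod.swap ⁻¹' S) := measurable_swap hS
  have h1 : (volume.prod volume : Measure ((n → n → ℝ) × ℝ)) (Prod.swap ⁻¹' S) = 0 := by
    rw [Measure.measure_prod_null hS']
    refine Filter.Eventually.of_forall fun A => ?_
    refine Set.Finite.measure_zero ?_ _
    refine (((-colMat A).charpoly.roots.toFinset : Finset ℝ).finite_toSet).subset fun t ht => ?_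
    have ht' : (colMat (A + t • I)).det = 0 := ht
    rw [hI, ← eval_charpoly] at ht'
    simp only [Finset.mem_coe, Multiset.mem_toFinset]
    exact (Polynomial.mem_roots (charpoly_monic _).ne_zero).2 ht'
  have h2 : (volume.prod volume : Measure (ℝ × (n → n → ℝ))) S = 0 := by
    rw [← Measure.prod_swap, Measure.map_apply measurable_swap hS]
    exact h1
  have h3 := Measure.measure_ae_null_of_prod_null h2
  obtain ⟨t, ht⟩ := h3.exists
  have h4 : Prod.mk t ⁻¹' S = (fun A => A + t • I) ⁻¹' {A : n → n → ℝ | (colMat A).det = 0} := rfl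
  have h5 : volume (Prod.mk t ⁻¹' S) = 0 := ht
  rwa [h4, measure_preimage_add_right] at h5

end SingularMatrices

/-! ### Measurable completion of a tuple to a matrix of determinant one. -/

section Completion

variable {ι κ : Type*} [Fintype ι] [DecidableEq ι] [Fintype κ] [DecidableEq κ]

theorem measurable_sum_elim :
    Measurable fun p : (ι → ι ⊕ κ → ℝ) × (κ → ι ⊕ κ → ℝ) => (Sum.elim p.1 p.2 : ι ⊕ κ → _) := by
  refine measurable_pi_lambda _ fun x => ?_
  rcases x with x | x <;> simp only [Sum.elim_inl, Sum.elim_inr] <;> fun_prop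

theorem continuous_sum_elim (v : ι → ι ⊕ κ → ℝ) :
    Continuous fun r : κ → ι ⊕ κ → ℝ => (Sum.elim v r : ι ⊕ κ → ι ⊕ κ → ℝ) := by
  refine continuous_pi fun x => ?_
  rcases x with x | x <;> simp only [Sum.elim_inl, Sum.elim_inr] <;> fun_prop

/-- A tuple of vectors is completable if it is part of a positively oriented basis. -/
def Completable (v : ι → ι ⊕ κ → ℝ) : Prop :=
  ∃ r : κ → ι ⊕ κ → ℝ, 0 < (colMat (Sum.elim v r)).det

theorem Completable.exists_denseSeq {v : ι → ι ⊕ κ → ℝ} (hv : Completable v) :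
    ∃ i, 0 < (colMat (Sum.elim v (TopologicalSpace.denseSeq (κ → ι ⊕ κ → ℝ) i))).det :=
  (TopologicalSpace.denseRange_denseSeq (κ → ι ⊕ κ → ℝ)).exists_mem_open
    (isOpen_Ioi.preimage (continuous_det_colMat.comp (continuous_sum_elim v))) hv

/-- Having positive determinant is an open condition, so a dense sequence contains a completion
whenever one exists. The second alternative makes `Nat.find` available for the remaining `v` too,
which gives a globally defined measurable choice. -/
theorem exists_completion_index (v : ι → ι ⊕ κ → ℝ) : ∃ i : ℕ,
    0 < (colMat (Sum.elim v (TopologicalSpace.denseSeq (κ → ι ⊕ κ → ℝ) i))).det ∨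
      ∀ l : ℕ, ¬ 0 < (colMat (Sum.elim v (TopologicalSpace.denseSeq (κ → ι ⊕ κ → ℝ) l))).det := by
  by_cases h : ∃ i : ℕ, 0 < (colMat (Sum.elim v (TopologicalSpace.denseSeq (κ → ι ⊕ κ → ℝ) i))).det
  · exact ⟨h.choose, Or.inl h.choose_spec⟩
  · exact ⟨0, Or.inr (not_exists.1 h)⟩

open Classical in
/-- A measurable choice of a matrix of determinant one with prescribed first columns. -/
def completion (j : κ) (v : ι → ι ⊕ κ → ℝ) : SpecialLinearGroup (ι ⊕ κ) ℝ :=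
  normalizeCol (Sum.inr j)
    (Sum.elim v (TopologicalSpace.denseSeq (κ → ι ⊕ κ → ℝ) (Nat.find (exists_completion_index v))))

theorem measurable_completion (j : κ) : Measurable (completion (ι := ι) j) := by
  classical
  have hdet : ∀ i : ℕ, Measurable fun v : ι → ι ⊕ κ → ℝ =>
      (colMat (Sum.elim v (TopologicalSpace.denseSeq (κ → ι ⊕ κ → ℝ) i))).det := fun i =>
    measurable_det_colMat.comp (measurable_sum_elim.comp (measurable_id.prodMk measurable_const))
  have hset : ∀ i : ℕ, MeasurableSet {v : ι → ι ⊕ κ → ℝ |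
      0 < (colMat (Sum.elim v (TopologicalSpace.denseSeq (κ → ι ⊕ κ → ℝ) i))).det} := fun i =>
    hdet i measurableSet_Ioi
  refine Measurable.find (f := fun i v => normalizeCol (Sum.inr j)
    (Sum.elim v (TopologicalSpace.denseSeq (κ → ι ⊕ κ → ℝ) i))) (fun i => ?_) (fun i => ?_)
    exists_completion_index
  · exact (measurable_normalizeCol _).comp
      (measurable_sum_elim.comp (measurable_id.prodMk measurable_const))
  · refine (hset i).union ?_
    have h := MeasurableSet.iInter fun l => (hset l).compl
    have he : ⋂ l : ℕ, {v : ι → ι ⊕ κ → ℝ |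
        0 < (colMat (Sum.elim v (TopologicalSpace.denseSeq (κ → ι ⊕ κ → ℝ) l))).det}ᶜ =
        {v | ∀ l : ℕ, ¬ 0 < (colMat (Sum.elim v
          (TopologicalSpace.denseSeq (κ → ι ⊕ κ → ℝ) l))).det} := by
      ext v
      simp only [mem_iInter, mem_compl_iff, mem_ofPred_eq]
    rw [he] at h
    exact h

/-- The first columns of a matrix. -/
def leftCols {R : Type*} (g : Matrix (ι ⊕ κ) (ι ⊕ κ) R) : ι → ι ⊕ κ → R := fun i l => g l (Sum.inl i)

theorem leftCols_normalizeCol (j : κ) (v : ι → ι ⊕ κ → ℝ) (r : κ → ι ⊕ κ → ℝ)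
    (h : 0 < (colMat (Sum.elim v r)).det) :
    leftCols (normalizeCol (Sum.inr j) (Sum.elim v r) : Matrix (ι ⊕ κ) (ι ⊕ κ) ℝ) = v := by
  funext i l
  rw [leftCols, coe_normalizeCol h, mul_diagonal, colMat_apply, Sum.elim_inl,
    Function.update_of_ne (by simp)]
  simp

theorem leftCols_completion (j : κ) {v : ι → ι ⊕ κ → ℝ} (hv : Completable v) :
    leftCols (completion j v : Matrix (ι ⊕ κ) (ι ⊕ κ) ℝ) = v := by
  classical
  refine leftCols_normalizeCol j v _ ?_
  rcases Nat.find_spec (exists_completion_index v) with h | h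
  · exact h
  · obtain ⟨i, hi⟩ := hv.exists_denseSeq
    exact absurd hi (h i)

theorem completable_leftCols (g : SpecialLinearGroup (ι ⊕ κ) ℝ) :
    Completable (leftCols (g : Matrix (ι ⊕ κ) (ι ⊕ κ) ℝ)) := by
  refine ⟨fun a l => (g : Matrix (ι ⊕ κ) (ι ⊕ κ) ℝ) l (Sum.inr a), ?_⟩
  have : colMat (Sum.elim (leftCols (g : Matrix (ι ⊕ κ) (ι ⊕ κ) ℝ))
      fun a l => (g : Matrix (ι ⊕ κ) (ι ⊕ κ) ℝ) l (Sum.inr a)) = g := by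
    ext i x
    rcases x with x | x <;> rfl
  rw [this, Matrix.SpecialLinearGroup.det_coe]
  exact zero_lt_one

/-- A negative determinant is corrected by changing the sign of the free column `j`. -/
theorem completable_of_det_ne_zero (j : κ) {v : ι → ι ⊕ κ → ℝ} {r : κ → ι ⊕ κ → ℝ}
    (h : (colMat (Sum.elim v r)).det ≠ 0) : Completable v := by
  rcases lt_or_gt_of_ne h with h | h
  · refine ⟨fun a l => Function.update (1 : κ → ℝ) j (-1) a * r a l, ?_⟩
    have : colMat (Sum.elim v fun a l => Function.update (1 : κ → ℝ) j (-1) a * r a l) =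
        colMat (Sum.elim v r) * diagonal (Sum.elim 1 (Function.update (1 : κ → ℝ) j (-1))) := by
      ext i x
      rcases x with x | x <;> simp [mul_comm]
    rw [this, det_mul, det_diagonal, Fintype.prod_sum_type]
    simp only [Sum.elim_inl, Pi.one_apply, Finset.prod_const_one, Sum.elim_inr, one_mul]
    rw [Finset.prod_update_of_mem (Finset.mem_univ j)]
    simp only [Pi.one_apply, Finset.prod_const_one, mul_one]
    linarith
  · exact ⟨r, h⟩

theorem volume_preserving_sum_elim :
    MeasurePreserving (fun p : (ι → ι ⊕ κ → ℝ) × (κ → ι ⊕ κ → ℝ) =>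
      (Sum.elim p.1 p.2 : ι ⊕ κ → ι ⊕ κ → ℝ)) (volume.prod volume) volume := by
  have h := (volume_measurePreserving_sumPiEquivProdPi (fun _ : ι ⊕ κ => ι ⊕ κ → ℝ)).symm
  have he : (fun p : (ι → ι ⊕ κ → ℝ) × (κ → ι ⊕ κ → ℝ) =>
      (Sum.elim p.1 p.2 : ι ⊕ κ → ι ⊕ κ → ℝ)) =
      (MeasurableEquiv.sumPiEquivProdPi fun _ : ι ⊕ κ => ι ⊕ κ → ℝ).symm := by
    funext p x
    rcases x with x | x <;> rfl
  rw [he]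
  exact h

/-- Over a tuple that is not completable, the whole fibre consists of singular matrices; by Fubini
such tuples form a null set. -/
theorem ae_completable (j : κ) : ∀ᵐ v : ι → ι ⊕ κ → ℝ, Completable (κ := κ) v := by
  have : Nonempty (ι ⊕ κ) := ⟨Sum.inr j⟩
  have h := volume_preserving_sum_elim (ι := ι) (κ := κ)
  have h1 := h.quasiMeasurePreserving.preimage_null (volume_det_eq_zero (n := ι ⊕ κ))
  filter_upwards [Measure.measure_ae_null_of_prod_null h1] with v hv
  by_contra hc
  have huniv : (Prod.mk v ⁻¹' ((fun p : (ι → ι ⊕ κ → ℝ) × (κ → ι ⊕ κ → ℝ) =>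
      (Sum.elim p.1 p.2 : ι ⊕ κ → ι ⊕ κ → ℝ)) ⁻¹' {A | (colMat A).det = 0})) = univ := by
    refine eq_univ_of_forall fun r => ?_
    by_contra hr
    exact hc (completable_of_det_ne_zero j hr)
  rw [huniv] at hv
  exact (isOpen_univ.measure_pos volume univ_nonempty).ne' hv

end Completion

/-! ### The integral of the weight for the stabiliser. -/

section Unfolding

variable {ι κ : Type*} [Fintype ι] [DecidableEq ι] [Fintype κ] [DecidableEq κ]

theorem normalizeCol_coe (j : κ) (g : SpecialLinearGroup κ ℝ) :
    normalizeCol j (fun a b => (g : Matrix κ κ ℝ) b a) = g := by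
  have h : colMat (fun a b => (g : Matrix κ κ ℝ) b a) = g := rfl
  have h1 : (colMat (fun a b => (g : Matrix κ κ ℝ) b a)).det = 1 := by
    rw [h, Matrix.SpecialLinearGroup.det_coe]
  apply sl_ext
  rw [coe_normalizeCol (by rw [h1]; exact zero_lt_one), h1, h, inv_one, show Function.update (1 : κ → ℝ) j 1 = 1 from Function.update_eq_self j _,
    show (diagonal (1 : κ → ℝ)) = 1 from diagonal_one, Matrix.mul_one]

open Classical in
/-- The weight of a block upper triangular matrix: its upper right block has to lie in the unit
box, and its lower right block is weighted by `slWeight`. -/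
def blockWeight (j : κ) (g : SpecialLinearGroup (ι ⊕ κ) ℝ) : ℝ≥0∞ :=
  (if ∀ i a, (g : Matrix (ι ⊕ κ) (ι ⊕ κ) ℝ) (Sum.inl i) (Sum.inr a) ∈ Ico (0 : ℝ) 1 then 1 else 0) *
    slWeight (normalizeCol j
      fun a b => (g : Matrix (ι ⊕ κ) (ι ⊕ κ) ℝ) (Sum.inr b) (Sum.inr a))

theorem measurable_blockWeight (j : κ) : Measurable (blockWeight (ι := ι) j) := by
  classical
  refine Measurable.mul (Measurable.ite ?_ measurable_const measurable_const) ?_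
  · simp only [ofPred_forall]
    exact MeasurableSet.iInter fun i => MeasurableSet.iInter fun a =>
      measurable_sl_apply _ _ measurableSet_Ico
  · refine isWeight_slWeight.measurable.comp ((measurable_normalizeCol j).comp ?_)
    exact measurable_pi_lambda _ fun a => measurable_pi_lambda _ fun b => measurable_sl_apply _ _

/-- A weight on `SL_n(ℝ)` for the stabiliser in `SL_n(ℤ)` of the first standard basis vectors. -/
def unfoldWeight (j : κ) (g : SpecialLinearGroup (ι ⊕ κ) ℝ) : ℝ≥0∞ :=
  blockWeight j ((completion j (leftCols (g : Matrix (ι ⊕ κ) (ι ⊕ κ) ℝ)))⁻¹ * g)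

theorem measurable_leftCols : Measurable fun g : SpecialLinearGroup (ι ⊕ κ) ℝ =>
    leftCols (g : Matrix (ι ⊕ κ) (ι ⊕ κ) ℝ) :=
  measurable_pi_lambda _ fun i => measurable_pi_lambda _ fun l => measurable_sl_apply l (Sum.inl i)

theorem measurable_unfoldWeight (j : κ) : Measurable (unfoldWeight (ι := ι) j) :=
  (measurable_blockWeight j).comp
    (((measurable_completion j).comp measurable_leftCols).inv.mul measurable_id)

/-- The first standard basis vectors. -/
def stdLeft (ι κ : Type*) [DecidableEq ι] [DecidableEq κ] : ι → ι ⊕ κ → ℝ :=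
  fun i => Pi.single (Sum.inl i) 1

theorem leftCols_eq_mulCols (g : Matrix (ι ⊕ κ) (ι ⊕ κ) ℝ) :
    leftCols g = mulCols g (stdLeft ι κ) := by
  funext i l
  simp [leftCols, mulCols, stdLeft]

theorem colMat_stdLeft (a : κ → ι → ℝ) (h : κ → κ → ℝ) :
    colMat (Sum.elim (stdLeft ι κ) fun c => Sum.elim (a c) (h c)) =
      fromBlocks 1 (Matrix.of a)ᵀ 0 (colMat h) := by
  ext x y
  rcases x with x | x <;> rcases y with y | y <;>
    simp [stdLeft, Pi.single_apply, Matrix.one_apply]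

theorem det_colMat_stdLeft (a : κ → ι → ℝ) (h : κ → κ → ℝ) :
    (colMat (Sum.elim (stdLeft ι κ) fun c => Sum.elim (a c) (h c))).det = (colMat h).det := by
  rw [colMat_stdLeft, det_fromBlocks_zero₂₁, det_one, one_mul]

theorem volume_preserving_blocks :
    MeasurePreserving (fun p : (κ → ι → ℝ) × (κ → κ → ℝ) =>
      (fun c => Sum.elim (p.1 c) (p.2 c) : κ → ι ⊕ κ → ℝ)) (volume.prod volume) volume := by
  have h1 := (volume_measurePreserving_arrowProdEquivProdArrow (ι → ℝ) (κ → ℝ) κ).symm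
  have h2 := (volume_measurePreserving_sumPiEquivProdPi (fun _ : ι ⊕ κ => ℝ)).symm
  have h3 := (volume_preserving_pi fun _ : κ => h2).comp h1
  have he : (fun p : (κ → ι → ℝ) × (κ → κ → ℝ) =>
      (fun c => Sum.elim (p.1 c) (p.2 c) : κ → ι ⊕ κ → ℝ)) =
      (fun a i => (MeasurableEquiv.sumPiEquivProdPi fun _ : ι ⊕ κ => ℝ).symm (a i)) ∘
        (MeasurableEquiv.arrowProdEquivProdArrow (ι → ℝ) (κ → ℝ) κ).symm := by
    funext p c x
    rcases x with x | x <;> rfl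
  rw [he]
  exact h3

/-- Normalising divides column `j` by the determinant, so before normalisation the unit box has side
`det` in that column. -/
theorem blockWeight_normalizeCol (j : κ) (a : κ → ι → ℝ) (h : κ → κ → ℝ)
    (hdet : 0 < (colMat h).det) :
    blockWeight j (normalizeCol (Sum.inr j)
      (Sum.elim (stdLeft ι κ) fun c => Sum.elim (a c) (h c))) =
      (univ.pi fun c => univ.pi fun _ : ι =>
        Ico (0 : ℝ) (Function.update (1 : κ → ℝ) j (colMat h).det c)).indicator 1 a *
        slWeight (normalizeCol j h) := by
  classical
  have hd := det_colMat_stdLeft a h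
  have hupd : ∀ c, Function.update (1 : ι ⊕ κ → ℝ) (Sum.inr j) (colMat h).det⁻¹ (Sum.inr c) =
      Function.update (1 : κ → ℝ) j (colMat h).det⁻¹ c := by
    intro c
    by_cases hc : c = j
    · subst hc; simp
    · simp [hc]
  unfold blockWeight
  simp only [coe_normalizeCol (j := Sum.inr j) (hd ▸ hdet), hd, mul_diagonal, hupd, colMat_apply,
    Sum.elim_inr, Sum.elim_inl]
  congr 1
  · rw [indicator_apply]
    refine if_congr ?_ rfl rfl
    simp only [mem_pi, mem_univ, true_imp_iff, mem_Ico]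
    rw [forall_comm]
    refine forall_congr' fun c => forall_congr' fun i => ?_
    by_cases hc : c = j
    · subst hc
      simp only [Function.update_self]
      rw [← div_eq_mul_inv, div_lt_one hdet, le_div_iff₀ hdet, zero_mul]
    · simp [Function.update_of_ne hc]
  · have he : (fun c b => h c b * Function.update (1 : κ → ℝ) j (colMat h).det⁻¹ c) =
        fun c b => (normalizeCol j h : Matrix κ κ ℝ) b c := by
      funext c b
      rw [coe_normalizeCol hdet, mul_diagonal, colMat_apply]
    rw [he, normalizeCol_coe]

theorem volume_unfold_box (j : κ) {t : ℝ} (ht : 0 < t) :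
    volume (univ.pi fun c => univ.pi fun _ : ι =>
        Ico (0 : ℝ) (Function.update (1 : κ → ℝ) j t c)) =
      ENNReal.ofReal (t ^ Fintype.card ι) := by
  rw [volume_pi_pi]
  simp only [volume_pi_pi, Real.volume_Ico, sub_zero, Finset.prod_const, Finset.card_univ]
  rw [Finset.prod_eq_single j]
  · rw [Function.update_self, ENNReal.ofReal_pow ht.le]
  · intro c _ hc
    simp [Function.update_of_ne hc]
  · simp

/-- Here the exponent in `detDensity` matters: the box for the upper right block has volume `det ^
|ι|`, which turns the density `det ^ (-(|ι| + |κ|))` into the density `det ^ (-|κ|)` defining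
`slHaar j` on the smaller group. The constant is then exactly `slCovolume j`. -/
theorem lintegral_blockWeight (j : κ) :
    ∫⁻ r : κ → ι ⊕ κ → ℝ, detDensity (Sum.elim (stdLeft ι κ) r) *
      blockWeight j (normalizeCol (Sum.inr j) (Sum.elim (stdLeft ι κ) r)) = slCovolume j := by
  classical
  have hm : Measurable fun r : κ → ι ⊕ κ → ℝ => detDensity (Sum.elim (stdLeft ι κ) r) *
      blockWeight j (normalizeCol (Sum.inr j) (Sum.elim (stdLeft ι κ) r)) := by
    have hs : Measurable fun r : κ → ι ⊕ κ → ℝ => (Sum.elim (stdLeft ι κ) r : ι ⊕ κ → _) :=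
      (continuous_sum_elim _).measurable
    exact (measurable_detDensity.comp hs).mul
      ((measurable_blockWeight j).comp ((measurable_normalizeCol _).comp hs))
  have hm' := hm.comp volume_preserving_blocks.measurable
  refine (volume_preserving_blocks.lintegral_comp hm).symm.trans
    ((lintegral_prod_symm _ hm'.aemeasurable).trans ?_)
  simp only [Function.comp_apply]
  rw [slCovolume, lintegral_slHaar j isWeight_slWeight.measurable]
  refine lintegral_congr fun h => ?_
  by_cases hh : (colMat h).det ∈ Icc (1 : ℝ) 2
  · have h0 : 0 < (colMat h).det := zero_lt_one.trans_le hh.1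
    have hdens : ∀ a : κ → ι → ℝ,
        detDensity (Sum.elim (stdLeft ι κ) fun c => Sum.elim (a c) (h c)) =
        ENNReal.ofReal ((colMat h).det⁻¹ ^ Fintype.card (ι ⊕ κ)) := by
      intro a
      rw [detDensity, det_colMat_stdLeft, if_pos hh]
    simp only [hdens, blockWeight_normalizeCol j _ h h0]
    rw [lintegral_const_mul' _ _ ENNReal.ofReal_ne_top, lintegral_mul_const',
      lintegral_indicator_one, volume_unfold_box j h0, ← mul_assoc, ← ENNReal.ofReal_mul,
      detDensity, if_pos hh]
    · congr 2
      rw [Fintype.card_sum, pow_add, mul_comm, ← mul_assoc, ← mul_pow, mul_inv_cancel₀ h0.ne',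
        one_pow, one_mul]
    · positivity
    · exact MeasurableSet.univ_pi fun c => MeasurableSet.univ_pi fun _ => measurableSet_Ico
    · exact ((isWeight_slWeight.le_one _).trans_lt ENNReal.one_lt_top).ne
  · have hdens : ∀ a : κ → ι → ℝ,
        detDensity (Sum.elim (stdLeft ι κ) fun c => Sum.elim (a c) (h c)) = 0 := by
      intro a
      rw [detDensity, det_colMat_stdLeft, if_neg hh]
    simp only [hdens]
    simp [detDensity, hh]

/-- Fubini separates the first columns `v` from the others `r`. Substituting `σ r` for `r`, with `σ`
the completion of `v`, preserves volume and reduces the inner integral to the standard first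
columns, so that it does not depend on `v`. -/
theorem lintegral_unfoldWeight (j : κ) {f : (ι → ι ⊕ κ → ℝ) → ℝ≥0∞} (hf : Measurable f) :
    ∫⁻ g : SpecialLinearGroup (ι ⊕ κ) ℝ,
        f (leftCols (g : Matrix (ι ⊕ κ) (ι ⊕ κ) ℝ)) * unfoldWeight j g ∂slHaar (Sum.inr j) =
      (∫⁻ v, f v) * slCovolume j := by
  have hm : Measurable fun g : SpecialLinearGroup (ι ⊕ κ) ℝ =>
      f (leftCols (g : Matrix (ι ⊕ κ) (ι ⊕ κ) ℝ)) * unfoldWeight j g :=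
    (hf.comp measurable_leftCols).mul (measurable_unfoldWeight j)
  have hm' := measurable_detDensity.mul (hm.comp (measurable_normalizeCol (Sum.inr j : ι ⊕ κ)))
  have hs := volume_preserving_sum_elim (ι := ι) (κ := κ)
  rw [lintegral_slHaar _ hm]
  refine (hs.lintegral_comp hm').symm.trans ?_
  refine (lintegral_prod _ (hm'.comp hs.measurable).aemeasurable).trans ?_
  rw [← lintegral_mul_const _ hf]
  refine lintegral_congr_ae ?_
  filter_upwards [ae_completable (ι := ι) j] with v hv
  have hσ := leftCols_completion j hv
  set σ := completion j v with hσdef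
  have hv' : ∀ r : κ → ι ⊕ κ → ℝ, (Sum.elim v (mulCols (σ : Matrix (ι ⊕ κ) (ι ⊕ κ) ℝ) r) :
      ι ⊕ κ → ι ⊕ κ → ℝ) = mulCols (σ : Matrix (ι ⊕ κ) (ι ⊕ κ) ℝ) (Sum.elim (stdLeft ι κ) r) := by
    intro r
    funext x
    rcases x with x | x
    · rw [Sum.elim_inl, ← hσ, leftCols_eq_mulCols]; rfl
    · rfl
  have hmv : Measurable fun r : κ → ι ⊕ κ → ℝ => detDensity (Sum.elim v r) *
      (f (leftCols (normalizeCol (Sum.inr j) (Sum.elim v r) : Matrix (ι ⊕ κ) (ι ⊕ κ) ℝ)) *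
        unfoldWeight j (normalizeCol (Sum.inr j) (Sum.elim v r))) :=
    hm'.comp (continuous_sum_elim v).measurable
  refine ((volume_preserving_mulCols σ).lintegral_comp hmv).symm.trans ?_
  rw [← lintegral_blockWeight (ι := ι) j, ← lintegral_const_mul]
  · refine lintegral_congr fun r => ?_
    have hdet : (colMat (mulCols (σ : Matrix (ι ⊕ κ) (ι ⊕ κ) ℝ) (Sum.elim (stdLeft ι κ) r))).det =
        (colMat (Sum.elim (stdLeft ι κ) r)).det := by
      rw [colMat_mulCols, det_mul, Matrix.SpecialLinearGroup.det_coe, one_mul]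
    by_cases h0 : detDensity (Sum.elim (stdLeft ι κ) r) = 0
    · rw [hv', detDensity_congr hdet, h0, zero_mul, zero_mul, mul_zero]
    · have hpos := zero_lt_one.trans_le (det_mem_of_detDensity_ne_zero h0).1
      have hl := leftCols_normalizeCol j v (mulCols (σ : Matrix (ι ⊕ κ) (ι ⊕ κ) ℝ) r) (by
        rw [hv', hdet]; exact hpos)
      rw [unfoldWeight, hl, ← hσdef, hv', detDensity_congr hdet, normalizeCol_mulCols _ _ _ hpos,
        inv_mul_cancel_left, mul_left_comm]
  · have hs : Measurable fun r : κ → ι ⊕ κ → ℝ => (Sum.elim (stdLeft ι κ) r : ι ⊕ κ → _) :=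
      (continuous_sum_elim _).measurable
    exact (measurable_detDensity.comp hs).mul
      ((measurable_blockWeight j).comp ((measurable_normalizeCol _).comp hs))

end Unfolding

/-! ### Summation over the stabiliser and the unfolding formula. -/

section UnfoldingSum

variable {ι κ : Type*} [Fintype ι] [DecidableEq ι] [Fintype κ] [DecidableEq κ]

/-- The integral block upper unitriangular-by-`SL` matrix with the given right blocks. -/
def blockInt (b : ι → κ → ℤ) (γ : SpecialLinearGroup κ ℤ) : SpecialLinearGroup (ι ⊕ κ) ℤ :=
  ⟨fromBlocks 1 (Matrix.of b) 0 (γ : Matrix κ κ ℤ), by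
    rw [det_fromBlocks_zero₂₁, det_one, one_mul, Matrix.SpecialLinearGroup.det_coe]⟩

theorem coe_blockInt (b : ι → κ → ℤ) (γ : SpecialLinearGroup κ ℤ) :
    (blockInt b γ : Matrix (ι ⊕ κ) (ι ⊕ κ) ℤ) = fromBlocks 1 (Matrix.of b) 0 (γ : Matrix κ κ ℤ) :=
  rfl

theorem coe_slInt_blockInt (b : ι → κ → ℤ) (γ : SpecialLinearGroup κ ℤ) :
    (slInt (blockInt b γ) : Matrix (ι ⊕ κ) (ι ⊕ κ) ℝ) =
      fromBlocks 1 (Matrix.of fun i c => (b i c : ℝ)) 0 (slInt γ : Matrix κ κ ℝ) := by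
  ext x y
  rw [slInt_apply, coe_blockInt]
  rcases x with x | x <;> rcases y with y | y <;> simp [Matrix.one_apply]

theorem leftCols_mul_blockInt (g : SpecialLinearGroup (ι ⊕ κ) ℤ) (b : ι → κ → ℤ)
    (γ : SpecialLinearGroup κ ℤ) :
    leftCols ((g * blockInt b γ : SpecialLinearGroup (ι ⊕ κ) ℤ) : Matrix (ι ⊕ κ) (ι ⊕ κ) ℤ) =
      leftCols (g : Matrix (ι ⊕ κ) (ι ⊕ κ) ℤ) := by
  funext i l
  simp [leftCols, Matrix.SpecialLinearGroup.coe_mul, coe_blockInt, Matrix.mul_apply,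
    Matrix.one_apply]

theorem exists_blockInt {q : SpecialLinearGroup (ι ⊕ κ) ℤ}
    (hq : leftCols (q : Matrix (ι ⊕ κ) (ι ⊕ κ) ℤ) = leftCols (1 : Matrix (ι ⊕ κ) (ι ⊕ κ) ℤ)) :
    ∃ p : (ι → κ → ℤ) × SpecialLinearGroup κ ℤ, blockInt p.1 p.2 = q := by
  have h1 : (q : Matrix (ι ⊕ κ) (ι ⊕ κ) ℤ) = fromBlocks 1
      (Matrix.of fun i c => (q : Matrix (ι ⊕ κ) (ι ⊕ κ) ℤ) (Sum.inl i) (Sum.inr c)) 0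
      (Matrix.of fun a c => (q : Matrix (ι ⊕ κ) (ι ⊕ κ) ℤ) (Sum.inr a) (Sum.inr c)) := by
    ext x y
    rcases y with y | y
    · have := congrFun (congrFun hq y) x
      simp only [leftCols] at this
      rw [this]
      rcases x with x | x <;> simp [Matrix.one_apply]
    · rcases x with x | x <;> simp
  have h2 := Matrix.SpecialLinearGroup.det_coe q
  rw [h1, det_fromBlocks_zero₂₁, det_one, one_mul] at h2
  refine ⟨⟨fun i c => (q : Matrix (ι ⊕ κ) (ι ⊕ κ) ℤ) (Sum.inl i) (Sum.inr c), ⟨_, h2⟩⟩, ?_⟩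
  exact Subtype.ext h1.symm

theorem blockInt_injective :
    Function.Injective fun p : (ι → κ → ℤ) × SpecialLinearGroup κ ℤ => blockInt p.1 p.2 := by
  rintro ⟨b, γ⟩ ⟨b', γ'⟩ h
  have h' : fromBlocks 1 (Matrix.of b) 0 (γ : Matrix κ κ ℤ) =
      fromBlocks 1 (Matrix.of b') 0 (γ' : Matrix κ κ ℤ) := congrArg Subtype.val h
  obtain ⟨-, h1, -, h2⟩ := fromBlocks_inj.1 h'
  exact Prod.ext h1 (Subtype.ext h2)

/-- The elements of `SL_n(ℤ)` with the same first columns as `γ₀` are parametrised by blocks. -/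
def fiberEquiv (γ₀ : SpecialLinearGroup (ι ⊕ κ) ℤ) : (ι → κ → ℤ) × SpecialLinearGroup κ ℤ ≃
    {γ : SpecialLinearGroup (ι ⊕ κ) ℤ // leftCols (γ : Matrix (ι ⊕ κ) (ι ⊕ κ) ℤ) =
      leftCols (γ₀ : Matrix (ι ⊕ κ) (ι ⊕ κ) ℤ)} :=
  Equiv.ofBijective (fun p => ⟨γ₀ * blockInt p.1 p.2, leftCols_mul_blockInt γ₀ p.1 p.2⟩) <| by
    refine ⟨fun p p' h => ?_, fun ⟨γ, hγ⟩ => ?_⟩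
    · exact blockInt_injective (mul_left_cancel (congrArg Subtype.val h))
    · have hq : leftCols ((γ₀⁻¹ * γ : SpecialLinearGroup (ι ⊕ κ) ℤ) : Matrix (ι ⊕ κ) (ι ⊕ κ) ℤ) =
          leftCols (1 : Matrix (ι ⊕ κ) (ι ⊕ κ) ℤ) := by
        have h1 : ((γ₀⁻¹ * γ₀ : SpecialLinearGroup (ι ⊕ κ) ℤ) : Matrix (ι ⊕ κ) (ι ⊕ κ) ℤ) = 1 := by
          rw [inv_mul_cancel, Matrix.SpecialLinearGroup.coe_one]
        rw [← h1]
        funext i l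
        have h2 : ∀ x, (γ : Matrix (ι ⊕ κ) (ι ⊕ κ) ℤ) x (Sum.inl i) =
            (γ₀ : Matrix (ι ⊕ κ) (ι ⊕ κ) ℤ) x (Sum.inl i) := fun x => congrFun (congrFun hγ i) x
        simp only [leftCols, Matrix.SpecialLinearGroup.coe_mul, Matrix.mul_apply, h2]
      obtain ⟨p, hp⟩ := exists_blockInt hq
      exact ⟨p, Subtype.ext (by simp [hp])⟩

theorem existsUnique_int_shift (c : ι → κ → ℝ) :
    ∃ b₀ : ι → κ → ℤ, ∀ b : ι → κ → ℤ, (∀ i a, (b i a : ℝ) + c i a ∈ Ico (0 : ℝ) 1) ↔ b = b₀ := by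
  refine ⟨fun i a => -⌊c i a⌋, fun b => ⟨fun h => ?_, ?_⟩⟩
  · funext i a
    have h1 := h i a
    have h2 : ⌊c i a⌋ = -b i a := by
      rw [Int.floor_eq_iff]
      push_cast
      constructor <;> linarith [h1.1, h1.2]
    rw [h2, neg_neg]
  · rintro rfl i a
    push_cast
    constructor <;> linarith [Int.floor_le (c i a), Int.lt_floor_add_one (c i a)]

/-- For each `γ` exactly one integral `b` moves the upper right block into the unit box; the sum
over `γ` that remains is a coset sum of `slWeight`. -/
theorem tsum_blockWeight (j : κ) (B : SpecialLinearGroup (ι ⊕ κ) ℝ)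
    (hB : leftCols (B : Matrix (ι ⊕ κ) (ι ⊕ κ) ℝ) = stdLeft ι κ) :
    ∑' p : (ι → κ → ℤ) × SpecialLinearGroup κ ℤ, blockWeight j (B * slInt (blockInt p.1 p.2)) =
      1 := by
  classical
  let a : Matrix ι κ ℝ :=
    Matrix.of fun i c => (B : Matrix (ι ⊕ κ) (ι ⊕ κ) ℝ) (Sum.inl i) (Sum.inr c)
  let h : Matrix κ κ ℝ :=
    Matrix.of fun i c => (B : Matrix (ι ⊕ κ) (ι ⊕ κ) ℝ) (Sum.inr i) (Sum.inr c)
  have h1 : (B : Matrix (ι ⊕ κ) (ι ⊕ κ) ℝ) = fromBlocks 1 a 0 h := by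
    ext x y
    rcases y with y | y
    · have := congrFun (congrFun hB y) x
      simp only [leftCols] at this
      rw [this]
      rcases x with x | x <;> simp [stdLeft, Matrix.one_apply, Pi.single_apply]
    · rcases x with x | x <;> simp [a, h]
  have hdet : h.det = 1 := by
    have h2 := Matrix.SpecialLinearGroup.det_coe B
    rwa [h1, det_fromBlocks_zero₂₁, det_one, one_mul] at h2
  have key : ∀ (b : ι → κ → ℤ) (γ : SpecialLinearGroup κ ℤ),
      blockWeight j (B * slInt (blockInt b γ)) =
        (if ∀ i c, (b i c : ℝ) + (a * (slInt γ : Matrix κ κ ℝ)) i c ∈ Ico (0 : ℝ) 1 then 1 else 0) *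
          slWeight (slMk h hdet * slInt γ) := by
    intro b γ
    have h3 : ((B * slInt (blockInt b γ) : SpecialLinearGroup (ι ⊕ κ) ℝ) :
        Matrix (ι ⊕ κ) (ι ⊕ κ) ℝ) = fromBlocks 1
          (Matrix.of (fun i c => (b i c : ℝ)) + a * (slInt γ : Matrix κ κ ℝ)) 0
          (h * (slInt γ : Matrix κ κ ℝ)) := by
      rw [Matrix.SpecialLinearGroup.coe_mul, h1, coe_slInt_blockInt, fromBlocks_multiply]
      simp
    unfold blockWeight
    rw [h3]
    congr 2
    have h4 := normalizeCol_coe j (slMk h hdet * slInt γ)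
    rw [Matrix.SpecialLinearGroup.coe_mul, coe_slMk] at h4
    exact h4
  rw [ENNReal.tsum_prod (f := fun b γ => blockWeight j (B * slInt (blockInt b γ))),
    ENNReal.tsum_comm]
  simp only [key, ENNReal.tsum_mul_right]
  refine Eq.trans (tsum_congr fun γ => ?_) (isWeight_slWeight.tsum_eq (slMk h hdet))
  obtain ⟨b₀, hb₀⟩ := existsUnique_int_shift fun i c => (a * (slInt γ : Matrix κ κ ℝ)) i c
  simp only [hb₀]
  rw [tsum_ite_eq, one_mul]

theorem leftCols_slInt (γ : SpecialLinearGroup (ι ⊕ κ) ℤ) :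
    leftCols (slInt γ : Matrix (ι ⊕ κ) (ι ⊕ κ) ℝ) =
      fun i l => ((leftCols (γ : Matrix (ι ⊕ κ) (ι ⊕ κ) ℤ) i l : ℤ) : ℝ) := rfl

theorem leftCols_mul (g h : SpecialLinearGroup (ι ⊕ κ) ℝ) :
    leftCols ((g * h : SpecialLinearGroup (ι ⊕ κ) ℝ) : Matrix (ι ⊕ κ) (ι ⊕ κ) ℝ) =
      mulCols (g : Matrix (ι ⊕ κ) (ι ⊕ κ) ℝ) (leftCols (h : Matrix (ι ⊕ κ) (ι ⊕ κ) ℝ)) := by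
  funext i l
  simp [leftCols, mulCols, Matrix.SpecialLinearGroup.coe_mul, Matrix.mul_apply, Matrix.mulVec,
    dotProduct]

/-- All elements of the fibre give the same first columns, hence the same completion `σ`.
Multiplying by `σ⁻¹` makes these columns standard, and the fibre is a coset of the integral block
matrices. -/
theorem tsum_unfoldWeight (j : κ) (g : SpecialLinearGroup (ι ⊕ κ) ℝ)
    (γ₀ : SpecialLinearGroup (ι ⊕ κ) ℤ) :
    ∑' γ : {γ : SpecialLinearGroup (ι ⊕ κ) ℤ // leftCols (γ : Matrix (ι ⊕ κ) (ι ⊕ κ) ℤ) =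
      leftCols (γ₀ : Matrix (ι ⊕ κ) (ι ⊕ κ) ℤ)}, unfoldWeight j (g * slInt γ.1) = 1 := by
  rw [← (fiberEquiv γ₀).tsum_eq]
  set σ := completion j (leftCols ((g * slInt γ₀ : SpecialLinearGroup (ι ⊕ κ) ℝ) :
    Matrix (ι ⊕ κ) (ι ⊕ κ) ℝ)) with hσ
  have hs := leftCols_completion j (completable_leftCols (g * slInt γ₀))
  rw [← hσ] at hs
  have hB : leftCols ((σ⁻¹ * (g * slInt γ₀) : SpecialLinearGroup (ι ⊕ κ) ℝ) :
      Matrix (ι ⊕ κ) (ι ⊕ κ) ℝ) = stdLeft ι κ := by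
    rw [leftCols_mul, ← hs, ← leftCols_mul, inv_mul_cancel, Matrix.SpecialLinearGroup.coe_one]
    funext i l
    simp [leftCols, stdLeft, Matrix.one_apply, Pi.single_apply]
  rw [← tsum_blockWeight j _ hB]
  refine tsum_congr fun p => ?_
  have hl : leftCols ((g * slInt (fiberEquiv γ₀ p).1 : SpecialLinearGroup (ι ⊕ κ) ℝ) :
      Matrix (ι ⊕ κ) (ι ⊕ κ) ℝ) = leftCols ((g * slInt γ₀ : SpecialLinearGroup (ι ⊕ κ) ℝ) :
      Matrix (ι ⊕ κ) (ι ⊕ κ) ℝ) := by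
    rw [leftCols_mul, leftCols_mul, leftCols_slInt, leftCols_slInt, (fiberEquiv γ₀ p).2]
  rw [unfoldWeight, hl, ← hσ]
  congr 1
  rw [show (fiberEquiv γ₀ p).1 = γ₀ * blockInt p.1 p.2 from rfl, map_mul]
  simp only [mul_assoc]

/-- The integral tuples that are the first columns of an element of `SL_n(ℤ)`. -/
def intPrimitive (ι κ : Type*) [Fintype ι] [DecidableEq ι] [Fintype κ] [DecidableEq κ] :
    Set (ι → ι ⊕ κ → ℤ) :=
  range fun γ : SpecialLinearGroup (ι ⊕ κ) ℤ => leftCols (γ : Matrix (ι ⊕ κ) (ι ⊕ κ) ℤ)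

/-- The sum over `SL_n(ℤ)` is grouped by first columns; on each group `f` is constant and the
weights add up to one. -/
theorem tsum_intPrimitive (j : κ) (f : (ι → ι ⊕ κ → ℝ) → ℝ≥0∞)
    (g : SpecialLinearGroup (ι ⊕ κ) ℝ) :
    ∑' γ, f (leftCols ((g * slInt γ : SpecialLinearGroup (ι ⊕ κ) ℝ) :
        Matrix (ι ⊕ κ) (ι ⊕ κ) ℝ)) * unfoldWeight j (g * slInt γ) =
      ∑' u : intPrimitive ι κ, f (mulCols (g : Matrix (ι ⊕ κ) (ι ⊕ κ) ℝ)
        fun i l => (u.1 i l : ℝ)) := by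
  rw [← (Equiv.sigmaFiberEquiv (rangeFactorization fun γ : SpecialLinearGroup (ι ⊕ κ) ℤ =>
    leftCols (γ : Matrix (ι ⊕ κ) (ι ⊕ κ) ℤ))).tsum_eq, ENNReal.tsum_sigma']
  refine tsum_congr fun u => ?_
  obtain ⟨_, γ₀, rfl⟩ := u
  rw [← mul_one (f _), ← tsum_unfoldWeight j g γ₀, ← ENNReal.tsum_mul_left]
  let e : {γ : SpecialLinearGroup (ι ⊕ κ) ℤ // rangeFactorization
      (fun γ : SpecialLinearGroup (ι ⊕ κ) ℤ => leftCols (γ : Matrix (ι ⊕ κ) (ι ⊕ κ) ℤ)) γ =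
        ⟨_, γ₀, rfl⟩} ≃
      {γ : SpecialLinearGroup (ι ⊕ κ) ℤ // leftCols (γ : Matrix (ι ⊕ κ) (ι ⊕ κ) ℤ) =
        leftCols (γ₀ : Matrix (ι ⊕ κ) (ι ⊕ κ) ℤ)} :=
    Equiv.subtypeEquivRight fun γ => Subtype.ext_iff
  rw [← e.tsum_eq]
  refine tsum_congr fun γ => ?_
  have hγ : leftCols (γ.1 : Matrix (ι ⊕ κ) (ι ⊕ κ) ℤ) =
    leftCols (γ₀ : Matrix (ι ⊕ κ) (ι ⊕ κ) ℤ) := (e γ).2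
  simp only [Equiv.sigmaFiberEquiv, Equiv.coe_fn_mk]
  rw [leftCols_mul, leftCols_slInt, hγ]
  rfl

/-- The unfolding formula. -/
theorem lintegral_tsum_intPrimitive (j : κ) {f : (ι → ι ⊕ κ → ℝ) → ℝ≥0∞} (hf : Measurable f) :
    ∫⁻ g : SpecialLinearGroup (ι ⊕ κ) ℝ, slWeight g * ∑' u : intPrimitive ι κ, f (mulCols (g : Matrix (ι ⊕ κ) (ι ⊕ κ) ℝ)
        fun i l => (u.1 i l : ℝ)) ∂slHaar (Sum.inr j) = (∫⁻ v, f v) * slCovolume j := by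
  refine Eq.trans ?_ (lintegral_unfoldWeight j hf)
  rw [← isWeight_slWeight.lintegral_eq (slHaar (Sum.inr j))
    (F := fun g : SpecialLinearGroup (ι ⊕ κ) ℝ => f (leftCols (g : Matrix (ι ⊕ κ) (ι ⊕ κ) ℝ)) * unfoldWeight j g)
    ((hf.comp measurable_leftCols).mul (measurable_unfoldWeight j))]
  simp only [tsum_intPrimitive]

end UnfoldingSum

/-! ### Transport of Haar measure and weights along a bijection of indices. -/

section Reindex

variable {m n : Type*} [Fintype m] [DecidableEq m] [Fintype n] [DecidableEq n]

/-- Reindexing of special linear groups. -/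
def slReindex (R : Type*) [CommRing R] (E : m ≃ n) :
    SpecialLinearGroup m R ≃* SpecialLinearGroup n R where
  toFun g := ⟨(g : Matrix m m R).submatrix E.symm E.symm, by
    rw [det_submatrix_equiv_self, Matrix.SpecialLinearGroup.det_coe]⟩
  invFun g := ⟨(g : Matrix n n R).submatrix E E, by
    rw [det_submatrix_equiv_self, Matrix.SpecialLinearGroup.det_coe]⟩
  left_inv g := by
    apply Matrix.SpecialLinearGroup.ext
    intro i j
    simp
  right_inv g := by
    apply Matrix.SpecialLinearGroup.ext
    intro i j
    simp
  map_mul' g h := by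
    apply Matrix.SpecialLinearGroup.ext
    intro i j
    simp only [Matrix.SpecialLinearGroup.coe_mul]
    exact congrFun (congrFun (submatrix_mul_equiv (g : Matrix m m R) (h : Matrix m m R)
      E.symm E.symm E.symm).symm i) j

theorem coe_slReindex {R : Type*} [CommRing R] (E : m ≃ n) (g : SpecialLinearGroup m R) :
    (slReindex R E g : Matrix n n R) = (g : Matrix m m R).submatrix E.symm E.symm := rfl

theorem slReindex_slInt (E : m ≃ n) (γ : SpecialLinearGroup m ℤ) :
    slReindex ℝ E (slInt γ) = slInt (slReindex ℤ E γ) := rfl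

theorem measurable_slReindex (E : m ≃ n) : Measurable (slReindex ℝ E) :=
  measurable_sl_iff.2 fun i j => measurable_sl_apply (E.symm i) (E.symm j)

theorem volume_preserving_reindex (E : m ≃ n) :
    MeasurePreserving (fun A : m → m → ℝ => (fun x y => A (E.symm x) (E.symm y) : n → n → ℝ))
      volume volume := by
  have h1 := volume_measurePreserving_piCongrLeft (fun _ : n => ℝ) E
  have h2 := volume_measurePreserving_piCongrLeft (fun _ : n => n → ℝ) E
  have h3 := h2.comp (volume_preserving_pi fun _ : m => h1)
  have he : (fun A : m → m → ℝ => (fun x y => A (E.symm x) (E.symm y) : n → n → ℝ)) =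
      (MeasurableEquiv.piCongrLeft (fun _ : n => n → ℝ) E) ∘
        fun (a : m → m → ℝ) (i : m) => MeasurableEquiv.piCongrLeft (fun _ : n => ℝ) E (a i) := by
    funext A x y
    obtain ⟨x, rfl⟩ := E.surjective x
    obtain ⟨y, rfl⟩ := E.surjective y
    simp [MeasurableEquiv.coe_piCongrLeft]
  rw [he]
  exact h3

theorem map_slReindex_slHaar (E : m ≃ n) (j : m) :
    Measure.map (slReindex ℝ E) (slHaar j) = slHaar (E j) := by
  refine Measure.ext_of_lintegral _ fun F hF => ?_
  rw [lintegral_map hF (measurable_slReindex E),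
    lintegral_slHaar j (F := fun g => F (slReindex ℝ E g)) (hF.comp (measurable_slReindex E)),
    lintegral_slHaar _ hF, ← (volume_preserving_reindex E).lintegral_comp
      (f := fun A => detDensity A * F (normalizeCol (E j) A))
      (measurable_detDensity.mul (hF.comp (measurable_normalizeCol _)))]
  refine lintegral_congr fun A => ?_
  have hc : colMat (fun x y => A (E.symm x) (E.symm y) : n → n → ℝ) =
      (colMat A).submatrix E.symm E.symm := rfl
  have hd : (colMat (fun x y => A (E.symm x) (E.symm y) : n → n → ℝ)).det = (colMat A).det := by
    rw [hc, det_submatrix_equiv_self]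
  have hdens : detDensity (fun x y => A (E.symm x) (E.symm y) : n → n → ℝ) = detDensity A := by
    simp only [detDensity, hd, Fintype.card_congr E]
  rw [hdens]
  by_cases h0 : detDensity A = 0
  · rw [h0, zero_mul, zero_mul]
  · have hpos := zero_lt_one.trans_le (det_mem_of_detDensity_ne_zero h0).1
    congr 2
    apply sl_ext
    rw [coe_slReindex, coe_normalizeCol hpos, coe_normalizeCol (by rw [hd]; exact hpos), hd, hc]
    ext x y
    simp only [submatrix_apply, mul_diagonal]
    congr 1
    by_cases hy : y = E j
    · subst hy; simp
    · rw [Function.update_of_ne hy, Function.update_of_ne (by rwa [Ne, E.symm_apply_eq])]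
      rfl

theorem isWeight_comp_slReindex (E : m ≃ n) {w : SpecialLinearGroup n ℝ → ℝ≥0∞}
    (hw : IsWeight w) : IsWeight fun g => w (slReindex ℝ E g) where
  measurable := hw.measurable.comp (measurable_slReindex E)
  pos g := hw.pos _
  tsum_eq g := by
    simp only [map_mul, slReindex_slInt]
    exact ((slReindex ℤ E).toEquiv.tsum_eq fun γ => w (slReindex ℝ E g * slInt γ)).trans
      (hw.tsum_eq _)

end Reindex

/-! ### The unfolding formula for the index type `Fin (d + e + 1)`. -/

section PrimitiveTuples

/-- The tuples of integer vectors formed by the first `d` columns of an element of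
`SL_{d+e+1}(ℤ)`. -/
def primInt (d e : ℕ) : Set (Fin d → Fin (d + e + 1) → ℤ) :=
  range fun (γ : SL(d + e + 1, ℤ)) i l =>
    (γ : Matrix (Fin (d + e + 1)) (Fin (d + e + 1)) ℤ) l (Fin.castAdd (e + 1) i)

/-- The image of a tuple of integer vectors under a real matrix. -/
def applyInt {ι n : Type*} [Fintype n] (g : Matrix n n ℝ) (u : ι → n → ℤ) : ι → n → ℝ :=
  mulCols g fun i l => (u i l : ℝ)

theorem applyInt_mul_slInt {ι n : Type*} [Fintype n] [DecidableEq n]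
    (g : SpecialLinearGroup n ℝ) (γ : SpecialLinearGroup n ℤ) (u : ι → n → ℤ) :
    applyInt ((g * slInt γ : SpecialLinearGroup n ℝ) : Matrix n n ℝ) u =
      applyInt (g : Matrix n n ℝ) fun i => (γ : Matrix n n ℤ) *ᵥ u i := by
  funext i
  simp only [applyInt, mulCols, Matrix.SpecialLinearGroup.coe_mul, ← Matrix.mulVec_mulVec]
  congr 1
  funext l
  simp [Matrix.mulVec, dotProduct]

/-- The sum of a function over the primitive tuples of the lattice `g ℤ^k`. -/
def primTsum {d e : ℕ} (f : (Fin d → Fin (d + e + 1) → ℝ) → ℝ≥0∞) (g : SL(d + e + 1, ℝ)) : ℝ≥0∞ :=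
  ∑' u : primInt d e, f (applyInt (g : Matrix (Fin (d + e + 1)) (Fin (d + e + 1)) ℝ) u.1)

theorem measurable_applyInt {ι n : Type*} [Fintype n] [DecidableEq n] (u : ι → n → ℤ) :
    Measurable fun g : SpecialLinearGroup n ℝ => applyInt (g : Matrix n n ℝ) u := by
  refine measurable_pi_lambda _ fun i => measurable_pi_lambda _ fun l => ?_
  simp only [applyInt, mulCols, Matrix.mulVec, dotProduct]
  exact Finset.measurable_sum _ fun x _ => (measurable_sl_apply l x).mul_const _

theorem measurable_primTsum {d e : ℕ} {f : (Fin d → Fin (d + e + 1) → ℝ) → ℝ≥0∞}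
    (hf : Measurable f) : Measurable (primTsum f) :=
  Measurable.tsum fun _ => hf.comp (measurable_applyInt _)

theorem mulVec_mem_primInt {d e : ℕ} (γ : SL(d + e + 1, ℤ)) {u : Fin d → Fin (d + e + 1) → ℤ}
    (hu : u ∈ primInt d e) :
    (fun i => (γ : Matrix (Fin (d + e + 1)) (Fin (d + e + 1)) ℤ) *ᵥ u i) ∈ primInt d e := by
  obtain ⟨γ', rfl⟩ := hu
  refine ⟨γ * γ', ?_⟩
  funext i l
  simp [Matrix.SpecialLinearGroup.coe_mul, Matrix.mul_apply, Matrix.mulVec, dotProduct]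

/-- The action of `SL_k(ℤ)` on integral primitive tuples. -/
def primIntEquiv {d e : ℕ} (γ : SL(d + e + 1, ℤ)) : primInt d e ≃ primInt d e where
  toFun u := ⟨_, mulVec_mem_primInt γ u.2⟩
  invFun u := ⟨_, mulVec_mem_primInt γ⁻¹ u.2⟩
  left_inv u := by
    apply Subtype.ext
    funext i
    simp only [Matrix.mulVec_mulVec, ← Matrix.SpecialLinearGroup.coe_mul, inv_mul_cancel,
      Matrix.SpecialLinearGroup.coe_one, Matrix.one_mulVec]
  right_inv u := by
    apply Subtype.ext
    funext i
    simp only [Matrix.mulVec_mulVec, ← Matrix.SpecialLinearGroup.coe_mul, mul_inv_cancel,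
      Matrix.SpecialLinearGroup.coe_one, Matrix.one_mulVec]

theorem primTsum_mul_slInt {d e : ℕ} (f : (Fin d → Fin (d + e + 1) → ℝ) → ℝ≥0∞)
    (g : SL(d + e + 1, ℝ)) (γ : SL(d + e + 1, ℤ)) : primTsum f (g * slInt γ) = primTsum f g := by
  simp only [primTsum, applyInt_mul_slInt]
  exact (primIntEquiv γ).tsum_eq fun u : primInt d e =>
    f (applyInt (g : Matrix (Fin (d + e + 1)) (Fin (d + e + 1)) ℝ) u.1)

theorem lintegral_primTsum {d e : ℕ} {f : (Fin d → Fin (d + e + 1) → ℝ) → ℝ≥0∞}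
    (hf : Measurable f) :
    ∫⁻ g, slWeight g * primTsum f g ∂slHaar (Fin.last (d + e)) =
      (∫⁻ v, f v) * slCovolume (Fin.last e) := by
  let E : Fin d ⊕ Fin (e + 1) ≃ Fin (d + e + 1) := finSumFinEquiv
  have hE : E (Sum.inr (Fin.last e)) = Fin.last (d + e) := rfl
  have hw : IsWeight fun g : SpecialLinearGroup (Fin d ⊕ Fin (e + 1)) ℝ =>
      slWeight (slReindex ℝ E g) := isWeight_comp_slReindex E isWeight_slWeight
  have hm : Measurable fun g => slWeight g * primTsum f g :=
    isWeight_slWeight.measurable.mul (measurable_primTsum hf)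
  rw [← hE, ← map_slReindex_slHaar, lintegral_map hm (measurable_slReindex E)]
  have hinv : ∀ (g : SpecialLinearGroup (Fin d ⊕ Fin (e + 1)) ℝ) γ,
      primTsum f (slReindex ℝ E (g * slInt γ)) = primTsum f (slReindex ℝ E g) := by
    intro g γ
    rw [map_mul, slReindex_slInt, primTsum_mul_slInt]
  -- The transported weight need not be the chosen one on the other group, but the choice is
  -- immaterial for an integrand invariant under `SL(ℤ)`.
  rw [hw.lintegral_congr isWeight_slWeight _ (H := fun g => primTsum f (slReindex ℝ E g))
    ((measurable_primTsum hf).comp (measurable_slReindex E)) hinv]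
  have hpres : MeasurePreserving (fun (v : Fin d → Fin d ⊕ Fin (e + 1) → ℝ) =>
      (fun i y => v i (E.symm y) : Fin d → Fin (d + e + 1) → ℝ)) volume volume := by
    have h1 := volume_measurePreserving_piCongrLeft (fun _ : Fin (d + e + 1) => ℝ) E
    have h2 := volume_preserving_pi fun _ : Fin d => h1
    have he : (fun (v : Fin d → Fin d ⊕ Fin (e + 1) → ℝ) =>
        (fun i y => v i (E.symm y) : Fin d → Fin (d + e + 1) → ℝ)) =
        fun v i => MeasurableEquiv.piCongrLeft (fun _ : Fin (d + e + 1) => ℝ) E (v i) := by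
      funext v i y
      obtain ⟨y, rfl⟩ := E.surjective y
      simp [MeasurableEquiv.coe_piCongrLeft]
    rw [he]
    exact h2
  rw [← hpres.lintegral_comp hf]
  refine Eq.trans (lintegral_congr fun g => ?_)
    (lintegral_tsum_intPrimitive (Fin.last e) (hf.comp hpres.measurable))
  congr 1
  let e' : primInt d e ≃ intPrimitive (Fin d) (Fin (e + 1)) :=
    { toFun := fun u => ⟨fun i x => u.1 i (E x), by
        obtain ⟨_, γ, rfl⟩ := u
        exact ⟨slReindex ℤ E.symm γ, rfl⟩⟩
      invFun := fun u => ⟨fun i x => u.1 i (E.symm x), by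
        obtain ⟨_, γ, rfl⟩ := u
        refine ⟨slReindex ℤ E γ, ?_⟩
        funext i l
        have : E.symm (Fin.castAdd (e + 1) i) = Sum.inl i := finSumFinEquiv_symm_apply_castAdd i
        simp only [coe_slReindex, submatrix_apply, leftCols]
        exact congrArg _ this⟩
      left_inv := fun u => by
        apply Subtype.ext
        funext i x
        simp
      right_inv := fun u => by
        apply Subtype.ext
        funext i x
        simp }
  rw [primTsum, ← e'.tsum_eq]
  refine tsum_congr fun u => congrArg f ?_
  funext i y
  simp only [applyInt, mulCols, Matrix.mulVec, dotProduct, coe_slReindex, submatrix_apply, e',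
    Equiv.coe_fn_mk]
  exact (E.symm.sum_comp fun x => (g : Matrix _ _ ℝ) (E.symm y) x * ((u.1 i (E x) : ℤ) : ℝ)).symm ▸
    Finset.sum_congr rfl fun x _ => by rw [E.apply_symm_apply]

end PrimitiveTuples

/-! ### Measures on `X_k` and Haar measure on `SL_k(ℝ)`. -/

section LatticeSpaceMeasure

variable {k : ℕ}

theorem slInt_mem_integerSL (γ : SL(k, ℤ)) : slInt γ ∈ integerSL k := ⟨γ, rfl⟩

theorem mem_integerSL_iff (g : SL(k, ℝ)) :
    g ∈ integerSL k ↔ ∀ i j, (g : Matrix (Fin k) (Fin k) ℝ) i j ∈ range (Int.cast : ℤ → ℝ) := by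
  constructor
  · rintro ⟨γ, rfl⟩ i j
    exact ⟨(γ : Matrix (Fin k) (Fin k) ℤ) i j, rfl⟩
  · intro h
    choose A hA using h
    have h1 : (Matrix.of A).map (Int.castRingHom ℝ) = (g : Matrix (Fin k) (Fin k) ℝ) := by
      ext i j
      simp [hA]
    have h2 : (Matrix.of A).det = 1 := by
      have h3 := RingHom.map_det (Int.castRingHom ℝ) (Matrix.of A)
      rw [RingHom.mapMatrix_apply, h1, Matrix.SpecialLinearGroup.det_coe] at h3
      exact Int.cast_injective (α := ℝ) (by simpa using h3)
    exact ⟨⟨Matrix.of A, h2⟩, sl_ext h1⟩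

theorem isClosed_integerSL : IsClosed (integerSL k : Set SL(k, ℝ)) := by
  have : (integerSL k : Set SL(k, ℝ)) = ⋂ i, ⋂ j,
      (fun g : SL(k, ℝ) => (g : Matrix (Fin k) (Fin k) ℝ) i j) ⁻¹' range (Int.cast : ℤ → ℝ) := by
    ext g
    simp only [SetLike.mem_coe, mem_integerSL_iff, mem_iInter, mem_preimage]
  rw [this]
  exact isClosed_iInter fun i => isClosed_iInter fun j =>
    Int.isClosedEmbedding_coe_real.isClosed_range.preimage (continuous_sl_apply i j)

instance instPolishSpaceSL {n : Type*} [Fintype n] [DecidableEq n] :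
    PolishSpace (SpecialLinearGroup n ℝ) :=
  haveI : PolishSpace (Matrix n n ℝ) := inferInstanceAs (PolishSpace (n → n → ℝ))
  IsClosed.polishSpace (s := {A : Matrix n n ℝ | A.det = 1})
    (isClosed_eq continuous_id.matrix_det continuous_const)

/-- The projection of `SL_k(ℝ)` onto the space of lattices. -/
def toLattice (g : SL(k, ℝ)) : LatticeSpace k := QuotientGroup.mk g

theorem toLattice_surjective : Function.Surjective (toLattice (k := k)) :=
  QuotientGroup.mk_surjective

theorem measurable_toLattice : Measurable (toLattice (k := k)) :=
  (show Continuous (toLattice (k := k)) from QuotientGroup.continuous_mk).measurable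

theorem toLattice_mul_slInt (g : SL(k, ℝ)) (γ : SL(k, ℤ)) :
    toLattice (g * slInt γ) = toLattice g :=
  QuotientGroup.mk_mul_of_mem g (slInt_mem_integerSL γ)

theorem exists_of_toLattice_eq {g h : SL(k, ℝ)} (H : toLattice g = toLattice h) :
    ∃ γ : SL(k, ℤ), h = g * slInt γ := by
  obtain ⟨γ, hγ⟩ := QuotientGroup.eq.1 H
  exact ⟨γ, by rw [show slInt γ = g⁻¹ * h from hγ, mul_inv_cancel_left]⟩

/-- A continuous surjection from a Polish space determines the Borel sets of its target; closedness
of `SL_k(ℤ)` provides the separation of the quotient that this requires. -/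
theorem measurable_of_comp_toLattice {F : LatticeSpace k → ℝ≥0∞}
    (hF : Measurable fun g => F (toLattice g)) : Measurable F := by
  have : IsClosed (integerSL k : Set SL(k, ℝ)) := isClosed_integerSL
  have h := Continuous.map_borel_eq (f := toLattice (k := k)) QuotientGroup.continuous_mk
    toLattice_surjective
  intro s hs
  have h2 : MeasurableSet[borel (LatticeSpace k)] (F ⁻¹' s) := by
    rw [← h]
    exact hF hs
  exact h2

/-- The sum of a function over the coset in `SL_k(ℝ)` that represents a lattice. -/
def cosetTsum (F : SL(k, ℝ) → ℝ≥0∞) (x : LatticeSpace k) : ℝ≥0∞ :=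
  ∑' γ : SL(k, ℤ), F (Quotient.out x * slInt γ)

theorem cosetTsum_toLattice (F : SL(k, ℝ) → ℝ≥0∞) (g : SL(k, ℝ)) :
    cosetTsum F (toLattice g) = ∑' γ : SL(k, ℤ), F (g * slInt γ) := by
  obtain ⟨γ₀, h0⟩ := exists_of_toLattice_eq (g := g) (h := Quotient.out (toLattice g))
    (show toLattice g = toLattice (Quotient.out (toLattice g)) from
      (QuotientGroup.out_eq' (toLattice g)).symm)
  rw [cosetTsum, h0]
  simp only [mul_assoc, ← map_mul]
  exact (Equiv.mulLeft γ₀).tsum_eq fun γ => F (g * slInt γ)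

theorem measurable_cosetTsum {F : SL(k, ℝ) → ℝ≥0∞} (hF : Measurable F) :
    Measurable (cosetTsum F) := by
  refine measurable_of_comp_toLattice ?_
  simp only [cosetTsum_toLattice]
  exact Measurable.tsum fun γ => hF.comp (measurable_mul_const _)

/-- The counting measure of the coset in `SL_k(ℝ)` that represents a lattice. -/
def cosetMeasure (x : LatticeSpace k) : Measure SL(k, ℝ) :=
  Measure.sum fun γ : SL(k, ℤ) => Measure.dirac (Quotient.out x * slInt γ)

theorem lintegral_cosetMeasure {F : SL(k, ℝ) → ℝ≥0∞} (hF : Measurable F) (x : LatticeSpace k) :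
    ∫⁻ g, F g ∂cosetMeasure x = cosetTsum F x := by
  rw [cosetMeasure, lintegral_sum_measure]
  exact tsum_congr fun γ => lintegral_dirac' _ hF

theorem measurable_cosetMeasure : Measurable (cosetMeasure (k := k)) := by
  refine Measure.measurable_of_measurable_coe _ fun s hs => ?_
  have h := measurable_cosetTsum (k := k) (F := s.indicator 1) (measurable_one.indicator hs)
  have he : (fun x => cosetMeasure x s) = cosetTsum (s.indicator 1) := by
    funext x
    rw [← lintegral_cosetMeasure (measurable_one.indicator hs), lintegral_indicator_one hs]
  rw [he]
  exact h

theorem lintegral_bind_cosetMeasure (μ : Measure (LatticeSpace k)) {F : SL(k, ℝ) → ℝ≥0∞}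
    (hF : Measurable F) : ∫⁻ g, F g ∂μ.bind cosetMeasure = ∫⁻ x, cosetTsum F x ∂μ := by
  rw [Measure.lintegral_bind measurable_cosetMeasure.aemeasurable hF.aemeasurable]
  simp only [lintegral_cosetMeasure hF]

/-- Left translation by `h` carries the counting measure of the coset `x` to that of `h • x`, so
invariance of `μ` lifts to the group. -/
theorem isMulLeftInvariant_bind_cosetMeasure (μ : Measure (LatticeSpace k))
    [SMulInvariantMeasure SL(k, ℝ) (LatticeSpace k) μ] :
    (μ.bind cosetMeasure).IsMulLeftInvariant := by
  refine ⟨fun h => Measure.ext_of_lintegral _ fun F hF => ?_⟩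
  rw [lintegral_map hF (measurable_const_mul h),
    lintegral_bind_cosetMeasure μ (F := fun g => F (h * g)) (hF.comp (measurable_const_mul h)),
    lintegral_bind_cosetMeasure μ hF,
    ← (measurePreserving_smul h μ).lintegral_comp (measurable_cosetTsum hF)]
  refine lintegral_congr fun x => ?_
  obtain ⟨g, rfl⟩ := toLattice_surjective x
  rw [show h • toLattice g = toLattice (h * g) from rfl, cosetTsum_toLattice, cosetTsum_toLattice]
  simp only [mul_assoc]

theorem cosetTsum_slWeight (x : LatticeSpace k) : cosetTsum slWeight x = 1 :=
  isWeight_slWeight.tsum_eq _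

/-- With density `slWeight` the lifted measure is finite, since the weight sums to one on cosets.
The density is positive and finite, so dividing it out keeps σ-finiteness. -/
theorem sigmaFinite_bind_cosetMeasure (μ : Measure (LatticeSpace k)) [IsFiniteMeasure μ] :
    SigmaFinite (μ.bind cosetMeasure) := by
  have hw := isWeight_slWeight (n := Fin k)
  have hfin : IsFiniteMeasure ((μ.bind cosetMeasure).withDensity slWeight) := by
    refine isFiniteMeasure_withDensity ?_
    rw [lintegral_bind_cosetMeasure μ hw.measurable]
    simp [cosetTsum_slWeight]
  rw [← withDensity_inv_same (μ := μ.bind cosetMeasure) hw.measurable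
    (Filter.Eventually.of_forall fun g => (hw.pos g).ne')
    (Filter.Eventually.of_forall fun g => ((hw.le_one g).trans_lt ENNReal.one_lt_top).ne)]
  exact SigmaFinite.withDensity_of_ne_top
    (Filter.Eventually.of_forall fun g => ENNReal.inv_ne_top.2 (hw.pos g).ne')

/-- Integration on the space of lattices in terms of the Haar measure of `SL_k(ℝ)`. -/
theorem IsNormalizedHaar.exists_const {μ : Measure (LatticeSpace k)} (hμ : IsNormalizedHaar μ)
    (j : Fin k) : ∃ c : ℝ≥0∞, c * slCovolume j = 1 ∧ ∀ H : LatticeSpace k → ℝ≥0∞, Measurable H →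
      ∫⁻ x, H x ∂μ = c * ∫⁻ g, slWeight g * H (toLattice g) ∂slHaar j := by
  have := hμ.isProbabilityMeasure
  have := hμ.smulInvariant
  have := isMulLeftInvariant_bind_cosetMeasure μ
  have := sigmaFinite_bind_cosetMeasure μ
  -- Uniqueness on the group, applied to the lift of `μ`, replaces a uniqueness argument on the
  -- quotient.
  obtain ⟨c, hc⟩ := exists_eq_smul_of_slBox (m := slHaar j) (m' := μ.bind cosetMeasure)
    (slHaar_ne_zero j) (slHaar_slBox_ne_top j)
  have hw := isWeight_slWeight (n := Fin k)
  have key : ∀ H : LatticeSpace k → ℝ≥0∞, Measurable H →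
      ∫⁻ x, H x ∂μ = c * ∫⁻ g, slWeight g * H (toLattice g) ∂slHaar j := by
    intro H hH
    have hm : Measurable fun g => slWeight g * H (toLattice g) :=
      hw.measurable.mul (hH.comp measurable_toLattice)
    rw [← smul_eq_mul, ← lintegral_smul_measure, ← hc, lintegral_bind_cosetMeasure μ hm]
    refine lintegral_congr fun x => ?_
    obtain ⟨g, rfl⟩ := toLattice_surjective x
    rw [cosetTsum_toLattice]
    simp only [toLattice_mul_slInt, ENNReal.tsum_mul_right, hw.tsum_eq, one_mul]
  refine ⟨c, ?_, key⟩
  have h1 := key 1 measurable_one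
  simpa [slCovolume] using h1.symm

/-- The pushforward of Haar measure with density `slWeight` is invariant: translation only replaces
the weight by another weight, which does not affect integrals of functions on the quotient. Finite
covolume allows normalisation. -/
theorem exists_isNormalizedHaar (j : Fin k) (hj : slCovolume j ≠ ∞) :
    ∃ μ : Measure (LatticeSpace k), IsNormalizedHaar μ := by
  have hw := isWeight_slWeight (n := Fin k)
  let μ₀ : Measure (LatticeSpace k) := Measure.map toLattice ((slHaar j).withDensity slWeight)
  have hμ₀ : ∀ H : LatticeSpace k → ℝ≥0∞, Measurable H →
      ∫⁻ x, H x ∂μ₀ = ∫⁻ g, slWeight g * H (toLattice g) ∂slHaar j := by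
    intro H hH
    rw [lintegral_map hH measurable_toLattice]
    exact lintegral_withDensity_eq_lintegral_mul _ hw.measurable (hH.comp measurable_toLattice)
  have hinv : ∀ h : SL(k, ℝ), Measure.map (fun x => h • x) μ₀ = μ₀ := by
    intro h
    refine Measure.ext_of_lintegral _ fun H hH => ?_
    have hw' : IsWeight fun g : SL(k, ℝ) => slWeight (h⁻¹ * g) :=
      { measurable := hw.measurable.comp (measurable_const_mul _)
        pos := fun g => hw.pos _
        tsum_eq := fun g => by simpa only [mul_assoc] using hw.tsum_eq (h⁻¹ * g) }
    rw [lintegral_map hH (measurable_const_smul h),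
      hμ₀ (fun x => H (h • x)) (hH.comp (measurable_const_smul h)), hμ₀ H hH,
      hw.lintegral_congr hw' _ (H := fun g => H (toLattice g)) (hH.comp measurable_toLattice)
        fun g γ => by rw [toLattice_mul_slInt],
      ← lintegral_mul_left_eq_self (fun g => slWeight (h⁻¹ * g) * H (toLattice g)) h]
    refine lintegral_congr fun g => ?_
    rw [inv_mul_cancel_left]
    rfl
  refine ⟨(slCovolume j)⁻¹ • μ₀, ⟨⟨?_⟩, ⟨fun h s hs => ?_⟩⟩⟩
  · have h1 := hμ₀ 1 measurable_one
    simp only [Pi.one_apply, mul_one, lintegral_one] at h1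
    rw [Measure.smul_apply, h1, smul_eq_mul]
    exact ENNReal.inv_mul_cancel (slCovolume_ne_zero j) hj
  · rw [Measure.smul_apply, Measure.smul_apply, ← Measure.map_apply (measurable_const_smul h) hs,
      hinv h]

end LatticeSpaceMeasure

/-! ### Primitive tuples and vectors in terms of `SL_k(ℤ)`. -/

section LatticeAlgebra

/-- Vectors of a `ℤ`-basis of `ℤ^k` form a primitive tuple. -/
theorem basis_comp_mem_primInt {d e : ℕ}
    (b : Module.Basis (Fin (d + e + 1)) ℤ (Fin (d + e + 1) → ℤ)) (ε : Fin d ↪ Fin (d + e + 1)) :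
    (fun i => b (ε i)) ∈ primInt d e := by
  classical
  let c : Fin d → Fin (d + e + 1) := Fin.castAdd (e + 1)
  have hc : Function.Injective c := Fin.castAdd_injective d (e + 1)
  have hlast : ∀ i, c i ≠ Fin.last (d + e) := fun i h => by
    have := congrArg Fin.val h
    simp only [c, Fin.val_castAdd, Fin.val_last] at this
    omega
  -- A permutation of the basis bringing the selected vectors to the first `d` places.
  let π : Equiv.Perm (Fin (d + e + 1)) := Equiv.extendSubtype (p := (· ∈ range c))
    (q := (· ∈ range ε)) ((Equiv.ofInjective c hc).symm.trans (Equiv.ofInjective ε ε.injective))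
  have hπ : ∀ i, π (c i) = ε i := by
    intro i
    have h1 := Equiv.extendSubtype_apply_of_mem (p := (· ∈ range c)) (q := (· ∈ range ε))
      ((Equiv.ofInjective c hc).symm.trans (Equiv.ofInjective ε ε.injective)) (c i) ⟨i, rfl⟩
    rw [h1]
    have h2 : (Equiv.ofInjective c hc).symm ⟨c i, i, rfl⟩ = i :=
      Equiv.ofInjective_symm_apply hc i
    simp only [Equiv.trans_apply]
    exact congrArg ε h2
  let M : Matrix (Fin (d + e + 1)) (Fin (d + e + 1)) ℤ := Matrix.of fun l x => b (π x) l
  have hM : IsUnit M.det := by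
    have h1 := Module.Basis.isUnit_det (Pi.basisFun ℤ (Fin (d + e + 1))) (b.reindex π.symm)
    rw [Module.Basis.det_apply] at h1
    have h2 : M = (Pi.basisFun ℤ (Fin (d + e + 1))).toMatrix (b.reindex π.symm) := by
      ext l x
      simp [M, Module.Basis.toMatrix_apply]
    rwa [h2]
  -- The determinant is `±1`. Multiplying the last column by it gives determinant one and leaves the
  -- first `d` columns alone, as there are at least `d + 1` columns.
  let s : ℤ := M.det
  have hs : s * s = 1 := Int.isUnit_mul_self hM
  refine ⟨⟨M * diagonal (Function.update (1 : Fin (d + e + 1) → ℤ) (Fin.last (d + e)) s), ?_⟩, ?_⟩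
  · rw [det_mul, det_diagonal, Finset.prod_update_of_mem (Finset.mem_univ _)]
    simpa using hs
  · funext i l
    have h1 : Function.update (1 : Fin (d + e + 1) → ℤ) (Fin.last (d + e)) s (c i) = 1 := by
      rw [Function.update_of_ne (hlast i)]; rfl
    have h2 : (M * diagonal (Function.update (1 : Fin (d + e + 1) → ℤ) (Fin.last (d + e)) s))
        l (c i) = b (ε i) l := by
      rw [mul_diagonal, h1, mul_one, ← hπ]
      rfl
    exact h2

/-- The map `ℤ^k → ℝ^k` given by a real matrix. -/
def latticeMap {k : ℕ} (g : SL(k, ℝ)) : (Fin k → ℤ) →ₗ[ℤ] (Fin k → ℝ) :=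
  Fintype.linearCombination ℤ (g : Matrix (Fin k) (Fin k) ℝ).col

theorem latticeMap_apply {k : ℕ} (g : SL(k, ℝ)) (z : Fin k → ℤ) :
    latticeMap g z = (g : Matrix (Fin k) (Fin k) ℝ) *ᵥ fun l => (z l : ℝ) := by
  funext l
  simp [latticeMap, Fintype.linearCombination_apply, Matrix.mulVec, dotProduct, mul_comm]

theorem mulVec_sl_injective {n : Type*} [Fintype n] [DecidableEq n] (g : SpecialLinearGroup n ℝ) :
    Function.Injective fun v : n → ℝ => (g : Matrix n n ℝ) *ᵥ v := by
  refine Matrix.mulVec_injective_of_isUnit ?_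
  rw [Matrix.isUnit_iff_isUnit_det, Matrix.SpecialLinearGroup.det_coe]
  exact isUnit_one

theorem latticeMap_injective {k : ℕ} (g : SL(k, ℝ)) : Function.Injective (latticeMap g) := by
  intro z z' h
  rw [latticeMap_apply, latticeMap_apply] at h
  have := mulVec_sl_injective g h
  funext l
  exact_mod_cast congrFun this l

theorem range_latticeMap {k : ℕ} (g : SL(k, ℝ)) :
    LinearMap.range (latticeMap g) = matrixLattice g :=
  Fintype.range_linearCombination ℤ _

/-- The isomorphism of `ℤ^k` with the lattice `g ℤ^k`. -/
def latticeEquiv {k : ℕ} (g : SL(k, ℝ)) : (Fin k → ℤ) ≃ₗ[ℤ] matrixLattice g :=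
  (LinearEquiv.ofInjective (latticeMap g) (latticeMap_injective g)).trans
    (LinearEquiv.ofEq _ _ (range_latticeMap g))

theorem coe_latticeEquiv {k : ℕ} (g : SL(k, ℝ)) (z : Fin k → ℤ) :
    (latticeEquiv g z : Fin k → ℝ) = latticeMap g z := rfl

theorem applyInt_eq_latticeMap {ι : Type*} {k : ℕ} (g : SL(k, ℝ)) (u : ι → Fin k → ℤ) :
    applyInt (g : Matrix (Fin k) (Fin k) ℝ) u = fun i => latticeMap g (u i) := by
  funext i
  rw [latticeMap_apply]
  rfl

theorem applyInt_injective {ι : Type*} {k : ℕ} (g : SL(k, ℝ)) :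
    Function.Injective (applyInt (ι := ι) (g : Matrix (Fin k) (Fin k) ℝ)) := by
  intro u u' h
  rw [applyInt_eq_latticeMap, applyInt_eq_latticeMap] at h
  funext i
  exact latticeMap_injective g (congrFun h i)

/-- `latticeEquiv` carries bases of `ℤ^k` to bases of the lattice, which reduces the intrinsic
definition to columns of matrices in `SL_k(ℤ)`. -/
theorem primitiveTuples_eq {d e : ℕ} (g : SL(d + e + 1, ℝ)) :
    primitiveTuples d (toLattice g).lattice =
      applyInt (g : Matrix (Fin (d + e + 1)) (Fin (d + e + 1)) ℝ) '' primInt d e := by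
  rw [show (toLattice g).lattice = matrixLattice g from rfl]
  ext v
  constructor
  · rintro ⟨b, ε, hb⟩
    refine ⟨_, basis_comp_mem_primInt (b.map (latticeEquiv g).symm) ε, ?_⟩
    rw [applyInt_eq_latticeMap]
    funext i
    rw [← coe_latticeEquiv, Module.Basis.map_apply, LinearEquiv.apply_symm_apply, hb]
  · rintro ⟨_, ⟨γ, rfl⟩, rfl⟩
    refine ⟨((Pi.basisFun ℤ _).map (Matrix.SpecialLinearGroup.toLin' γ)).map (latticeEquiv g),
      ⟨Fin.castAdd (e + 1), Fin.castAdd_injective d (e + 1)⟩, fun i => ?_⟩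
    rw [applyInt_eq_latticeMap, Module.Basis.map_apply, coe_latticeEquiv]
    congr 1
    funext l
    simp [Matrix.SpecialLinearGroup.toLin'_apply]

/-- The sum over primitive tuples of a lattice, for functions with values in `[0, ∞]`. -/
def latticeTsum {d e : ℕ} (f : (Fin d → Fin (d + e + 1) → ℝ) → ℝ≥0∞)
    (x : LatticeSpace (d + e + 1)) : ℝ≥0∞ :=
  ∑' v : primitiveTuples d x.lattice, f v

theorem latticeTsum_toLattice {d e : ℕ} (f : (Fin d → Fin (d + e + 1) → ℝ) → ℝ≥0∞)
    (g : SL(d + e + 1, ℝ)) : latticeTsum f (toLattice g) = primTsum f g := by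
  rw [latticeTsum, primitiveTuples_eq,
    tsum_image (f := f) ((applyInt_injective g).injOn (s := primInt d e))]
  rfl

theorem measurable_latticeTsum {d e : ℕ} {f : (Fin d → Fin (d + e + 1) → ℝ) → ℝ≥0∞}
    (hf : Measurable f) : Measurable (latticeTsum f) := by
  refine measurable_of_comp_toLattice ?_
  simp only [latticeTsum_toLattice]
  exact measurable_primTsum hf

/-- A nonzero integer vector is a positive multiple of a primitive one. -/
theorem exists_primitive {e : ℕ} {z : Fin (1 + e + 1) → ℤ} (hz : z ≠ 0) :
    ∃ m : ℕ, ∃ u ∈ primInt 1 e, (m + 1 : ℤ) • u 0 = z := by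
  -- Smith normal form of the rank one module `ℤ z` makes `z` a multiple of a vector of some basis
  -- of `ℤ^k`.
  obtain ⟨n, ⟨bM, bN, f, a, snf⟩⟩ :=
    Submodule.smithNormalForm (Pi.basisFun ℤ (Fin (1 + e + 1))) (Submodule.span ℤ {z})
  have hn : n = 1 := by
    have h1 := (LinearEquiv.toSpanNonzeroSingleton ℤ (Fin (1 + e + 1) → ℤ) z hz).finrank_eq
    rw [Module.finrank_self, Module.finrank_eq_card_basis bN, Fintype.card_fin] at h1
    exact h1.symm
  subst hn
  obtain ⟨t, ht⟩ : ∃ t : ℤ, t • bM (f 0) = z := by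
    have h1 := bN.sum_repr ⟨z, Submodule.mem_span_singleton_self z⟩
    rw [Fin.sum_univ_one] at h1
    have h2 := congrArg Subtype.val h1
    simp only [Submodule.coe_smul, snf] at h2
    exact ⟨_, by rw [← h2, smul_smul]⟩
  have ht0 : t ≠ 0 := by
    rintro rfl
    exact hz (by rw [← ht, zero_smul])
  rcases lt_or_gt_of_ne ht0 with h | h
  -- A negative factor is made positive by negating the basis. Multiples are indexed as `m + 1`,
  -- whence the shift by one.
  · refine ⟨(-t - 1).toNat, fun _ => -bM (f 0), ?_, ?_⟩
    · have := basis_comp_mem_primInt (bM.map (LinearEquiv.neg ℤ))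
        ⟨fun _ : Fin 1 => f 0, Function.injective_of_subsingleton _⟩
      simpa using this
    · rw [← ht, Int.toNat_of_nonneg (by omega)]
      simp
  · refine ⟨(t - 1).toNat, fun _ => bM (f 0), ?_, ?_⟩
    · exact basis_comp_mem_primInt bM
        ⟨fun _ : Fin 1 => f 0, Function.injective_of_subsingleton _⟩
    · rw [← ht, Int.toNat_of_nonneg (by omega)]
      simp

theorem primInt_ne_zero {e : ℕ} {u : Fin 1 → Fin (1 + e + 1) → ℤ} (hu : u ∈ primInt 1 e) :
    u 0 ≠ 0 := by
  obtain ⟨γ, rfl⟩ := hu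
  intro h
  have h1 := Matrix.SpecialLinearGroup.det_coe γ
  rw [Matrix.det_eq_zero_of_column_eq_zero (Fin.castAdd (e + 1) 0) fun i => congrFun h i] at h1
  exact zero_ne_one h1

/-- Applying `γ⁻¹` turns `u' 0` into a standard basis vector; the corresponding coordinate of the
equation exhibits `m'` as a multiple of `m`. -/
theorem dvd_of_smul_primInt {e : ℕ} {u u' : Fin 1 → Fin (1 + e + 1) → ℤ} (hu' : u' ∈ primInt 1 e)
    {m m' : ℤ} (h : m • u 0 = m' • u' 0) : m ∣ m' := by
  obtain ⟨γ, rfl⟩ := hu'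
  set c : Fin (1 + e + 1) := Fin.castAdd (e + 1) 0 with hc
  have h1 : ((γ⁻¹ : SL(1 + e + 1, ℤ)) : Matrix (Fin (1 + e + 1)) (Fin (1 + e + 1)) ℤ) *ᵥ
      (fun l => (γ : Matrix (Fin (1 + e + 1)) (Fin (1 + e + 1)) ℤ) l c) = Pi.single c 1 := by
    rw [show (fun l => (γ : Matrix (Fin (1 + e + 1)) (Fin (1 + e + 1)) ℤ) l c) =
      (γ : Matrix (Fin (1 + e + 1)) (Fin (1 + e + 1)) ℤ) *ᵥ Pi.single c 1 by
        rw [Matrix.mulVec_single_one]; rfl, Matrix.mulVec_mulVec,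
      ← Matrix.SpecialLinearGroup.coe_mul, inv_mul_cancel, Matrix.SpecialLinearGroup.coe_one,
      Matrix.one_mulVec]
  have h2 := congrArg (fun v => (((γ⁻¹ : SL(1 + e + 1, ℤ)) :
    Matrix (Fin (1 + e + 1)) (Fin (1 + e + 1)) ℤ) *ᵥ v) c) h
  simp only [Matrix.mulVec_smul] at h2
  rw [h1] at h2
  simp only [Pi.smul_apply, Pi.single_eq_same, smul_eq_mul, mul_one] at h2
  exact ⟨_, h2.symm⟩

/-- Nonzero integer vectors are the positive multiples of primitive ones, in a unique way. -/
theorem bijective_smul_primInt (e : ℕ) : Function.Bijective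
    fun p : ℕ × primInt 1 e => (⟨((p.1 + 1 : ℕ) : ℤ) • p.2.1 0, fun h => by
      rcases smul_eq_zero.1 h with h | h
      · exact absurd h (by positivity)
      · exact primInt_ne_zero p.2.2 h⟩ : {z : Fin (1 + e + 1) → ℤ // z ≠ 0}) := by
  constructor
  · rintro ⟨m, u, hu⟩ ⟨m', u', hu'⟩ h
    have h1 : ((m + 1 : ℕ) : ℤ) • u 0 = ((m' + 1 : ℕ) : ℤ) • u' 0 := congrArg Subtype.val h
    have h2 := dvd_of_smul_primInt hu' h1
    have h3 := dvd_of_smul_primInt hu h1.symm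
    have h4 : m = m' := by
      have := Nat.dvd_antisymm (Int.natCast_dvd_natCast.1 h2) (Int.natCast_dvd_natCast.1 h3)
      omega
    subst h4
    have h5 : u 0 = u' 0 := smul_right_injective _ (by positivity : ((m + 1 : ℕ) : ℤ) ≠ 0) h1
    have h6 : u = u' := by
      funext i
      rw [Subsingleton.elim i 0, h5]
    subst h6
    rfl
  · rintro ⟨z, hz⟩
    obtain ⟨m, u, hu, h⟩ := exists_primitive hz
    exact ⟨(m, ⟨u, hu⟩), Subtype.ext (by simpa using h)⟩

end LatticeAlgebra

/-! ### Finite covolume by Minkowski's theorem, and the mean value formula. -/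

section FiniteCovolume

/-- Minkowski's theorem for the lattice `g ℤ^k` and the unit cube. -/
theorem exists_latticeMap_mem_closedBall {k : ℕ} [NeZero k] (g : SL(k, ℝ)) :
    ∃ z : Fin k → ℤ, z ≠ 0 ∧ latticeMap g z ∈ Metric.closedBall (0 : Fin k → ℝ) 1 := by
  have : Nonempty (Fin k) := ⟨0⟩
  let b : Module.Basis (Fin k) ℝ (Fin k → ℝ) :=
    (Pi.basisFun ℝ (Fin k)).map (Matrix.SpecialLinearGroup.toLin' g)
  have hb : (b : Fin k → Fin k → ℝ) = (g : Matrix (Fin k) (Fin k) ℝ).col := by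
    funext i l
    simp [b, Matrix.SpecialLinearGroup.toLin'_apply]
  have hvol : volume (ZSpan.fundamentalDomain b) = 1 := by
    rw [ZSpan.volume_fundamentalDomain, hb]
    have : Matrix.of (g : Matrix (Fin k) (Fin k) ℝ).col = (g : Matrix (Fin k) (Fin k) ℝ)ᵀ := rfl
    rw [this, det_transpose, Matrix.SpecialLinearGroup.det_coe]
    simp
  have hfd := ZSpan.isAddFundamentalDomain b volume
  have : Countable (Submodule.span ℤ (range b)).toAddSubgroup :=
    inferInstanceAs (Countable (Submodule.span ℤ (range b)))
  have : DiscreteTopology (Submodule.span ℤ (range b)).toAddSubgroup :=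
    inferInstanceAs (DiscreteTopology (Submodule.span ℤ (range b)))
  -- The cube has volume exactly `2 ^ k` and the covolume is 1; the borderline case of Minkowski's
  -- theorem is allowed because the cube is compact.
  obtain ⟨x, hx0, hx⟩ := exists_ne_zero_mem_lattice_of_measure_mul_two_pow_le_measure
    (L := (Submodule.span ℤ (range b)).toAddSubgroup)
    (s := Metric.closedBall (0 : Fin k → ℝ) 1) hfd (fun v hv => by simpa using hv)
    (convex_closedBall 0 1) (isCompact_closedBall 0 1) (by
      rw [hvol, Real.volume_pi_closedBall _ zero_le_one]
      simp)
  have hx1 : (x : Fin k → ℝ) ∈ LinearMap.range (latticeMap g) := by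
    rw [range_latticeMap, matrixLattice, ← hb]
    exact x.2
  obtain ⟨z, hz⟩ := hx1
  refine ⟨z, ?_, by rw [hz]; exact hx⟩
  rintro rfl
  rw [map_zero] at hz
  exact hx0 (Subtype.ext hz.symm)

/-- Minkowski's vector is a positive integral multiple of a primitive vector, which is no longer and
so also lies in the unit cube. -/
theorem one_le_primTsum {e : ℕ} (g : SL(1 + e + 1, ℝ)) :
    1 ≤ primTsum (d := 1) ((Metric.closedBall (0 : Fin 1 → Fin (1 + e + 1) → ℝ) 1).indicator 1)
      g := by
  obtain ⟨z, hz0, hz⟩ := exists_latticeMap_mem_closedBall g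
  obtain ⟨m, u, hu, rfl⟩ := exists_primitive hz0
  refine le_trans ?_ (ENNReal.le_tsum (⟨u, hu⟩ : primInt 1 e))
  rw [indicator_of_mem, Pi.one_apply]
  rw [applyInt_eq_latticeMap, mem_closedBall_zero_iff, pi_norm_le_iff_of_nonneg zero_le_one]
  intro i
  rw [Subsingleton.elim i 0]
  rw [map_smul, mem_closedBall_zero_iff, ← Int.cast_smul_eq_zsmul ℝ, norm_smul] at hz
  refine le_trans ?_ hz
  have h1 : 1 ≤ ‖((m + 1 : ℤ) : ℝ)‖ := by
    rw [Real.norm_eq_abs]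
    refine le_trans ?_ (le_abs_self _)
    push_cast
    linarith [Nat.cast_nonneg (α := ℝ) m]
  exact le_mul_of_one_le_left (norm_nonneg _) h1

/-- The weight is integrated against the bound `1 ≤ primTsum`, and the right side is unfolded with
`d = 1`. -/
theorem slCovolume_succ_le (e : ℕ) : slCovolume (Fin.last (1 + e)) ≤
    volume (Metric.closedBall (0 : Fin 1 → Fin (1 + e + 1) → ℝ) 1) * slCovolume (Fin.last e) := by
  rw [← lintegral_indicator_one Metric.isClosed_closedBall.measurableSet,
    ← lintegral_primTsum (measurable_one.indicator Metric.isClosed_closedBall.measurableSet),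
    slCovolume]
  exact lintegral_mono fun g => le_mul_of_one_le_right zero_le (one_le_primTsum g)

/-- `SL_k(ℤ)` has finite covolume in `SL_k(ℝ)`. -/
theorem slCovolume_ne_top (e : ℕ) : slCovolume (Fin.last e) ≠ ∞ := by
  induction e with
  | zero =>
    have h : slBox (n := Fin (0 + 1)) 1 = univ := by
      refine eq_univ_of_forall fun g i j => ?_
      have h1 : Subsingleton (Fin (0 + 1)) := inferInstanceAs (Subsingleton (Fin 1))
      rw [Subsingleton.elim g 1, Subsingleton.elim i j, Matrix.SpecialLinearGroup.coe_one]
      simp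
    refine ne_top_of_le_ne_top (slHaar_slBox_ne_top (Fin.last 0) 1) ?_
    rw [h, ← lintegral_one]
    exact lintegral_mono fun g => isWeight_slWeight.le_one g
  | succ e ih =>
    rw [← Nat.add_comm 1 e]
    exact ne_top_of_le_ne_top (ENNReal.mul_ne_top measure_closedBall_lt_top.ne ih)
      (slCovolume_succ_le e)

/-- The mean value formula with the constant expressed by covolumes. -/
theorem lintegral_latticeTsum {d e : ℕ} {μ : Measure (LatticeSpace (d + e + 1))}
    (hμ : IsNormalizedHaar μ) {f : (Fin d → Fin (d + e + 1) → ℝ) → ℝ≥0∞} (hf : Measurable f) :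
    ∫⁻ x, latticeTsum f x ∂μ =
      slCovolume (Fin.last e) / slCovolume (Fin.last (d + e)) * ∫⁻ v, f v := by
  obtain ⟨c, hc, h⟩ := hμ.exists_const (Fin.last (d + e))
  rw [h _ (measurable_latticeTsum hf)]
  simp only [latticeTsum_toLattice]
  rw [lintegral_primTsum hf, ENNReal.eq_inv_of_mul_eq_one_left hc, div_eq_mul_inv]
  ring

end FiniteCovolume

/-! ### Counting the points of one lattice in large cubes. -/

section PointCount

open scoped Pointwise

variable {k : ℕ}

/-- The number of points of the lattice `g ℤ^k` in the cube `[-R, R]^k`. -/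
def cubeCount (g : SL(k, ℝ)) (R : ℝ) : ℝ≥0∞ :=
  ∑' z : Fin k → ℤ, (Metric.closedBall (0 : Fin k → ℝ) R).indicator 1 (latticeMap g z)

theorem mem_cube_iff {v : Fin k → ℝ} {R : ℝ} (hR : 0 ≤ R) :
    v ∈ Metric.closedBall (0 : Fin k → ℝ) R ↔ ∀ l, |v l| ≤ R := by
  rw [mem_closedBall_zero_iff, pi_norm_le_iff_of_nonneg hR]
  rfl

/-- This supplies the dominating function for the limit of mean counts. The cube `[-n, n]^k` is
sorted by coordinatewise floors into `(2n + 1)^k` cells. Subtracting one lattice point of a cell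
from the others puts their differences in the unit cube. -/
theorem cubeCount_le (g : SL(k, ℝ)) (n : ℕ) :
    cubeCount g n ≤ (2 * n + 1 : ℝ≥0∞) ^ k * cubeCount g 1 := by
  classical
  let T : Finset (Fin k → ℤ) := Fintype.piFinset fun _ => Finset.Icc (-(n : ℤ)) n
  let A : (Fin k → ℤ) → Set (Fin k → ℤ) := fun t => {z | ∀ l, ⌊latticeMap g z l⌋ = t l}
  have hT : (T.card : ℝ≥0∞) = (2 * n + 1 : ℝ≥0∞) ^ k := by
    have h : (n + 1 + n : ℤ).toNat = 2 * n + 1 := by omega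
    simp [T, Fintype.card_piFinset, h]
  have hA : ∀ t, ∑' z, (A t).indicator (1 : (Fin k → ℤ) → ℝ≥0∞) z ≤ cubeCount g 1 := by
    intro t
    by_cases h : ∃ z₀, z₀ ∈ A t
    · obtain ⟨z₀, h0⟩ := h
      rw [cubeCount, ← (Equiv.subRight z₀).tsum_eq fun z =>
        (Metric.closedBall (0 : Fin k → ℝ) 1).indicator 1 (latticeMap g z)]
      refine ENNReal.tsum_le_tsum fun z => ?_
      by_cases hz : z ∈ A t
      · rw [indicator_of_mem hz, indicator_of_mem]
        · exact le_rfl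
        · rw [mem_cube_iff zero_le_one, Equiv.subRight_apply, map_sub]
          intro l
          have h1 : ⌊latticeMap g z l⌋ = ⌊latticeMap g z₀ l⌋ := (hz l).trans (h0 l).symm
          exact (Int.abs_sub_lt_one_of_floor_eq_floor h1).le
      · rw [indicator_of_notMem hz]
        exact zero_le
    · push Not at h
      simp [indicator_of_notMem (h _)]
  calc cubeCount g n
      ≤ ∑' z, ∑ t ∈ T, (A t).indicator (1 : (Fin k → ℤ) → ℝ≥0∞) z := by
        refine ENNReal.tsum_le_tsum fun z => ?_
        by_cases hz : latticeMap g z ∈ Metric.closedBall (0 : Fin k → ℝ) (n : ℝ)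
        · rw [indicator_of_mem hz]
          have hzT : (fun l => ⌊latticeMap g z l⌋) ∈ T := by
            rw [mem_cube_iff n.cast_nonneg] at hz
            simp only [T, Fintype.mem_piFinset, Finset.mem_Icc]
            intro l
            have h1 := abs_le.1 (hz l)
            refine ⟨Int.le_floor.2 (by push_cast; exact h1.1), ?_⟩
            have h2 : (⌊latticeMap g z l⌋ : ℝ) ≤ n := (Int.floor_le _).trans h1.2
            exact_mod_cast h2
          refine le_trans ?_ (Finset.single_le_sum (f := fun t => (A t).indicator (1 : (Fin k → ℤ) → ℝ≥0∞) z)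
            (fun _ _ => zero_le) hzT)
          rw [indicator_of_mem]
          · exact le_rfl
          · exact fun l => rfl
        · rw [indicator_of_notMem hz]
          exact zero_le
    _ = ∑ t ∈ T, ∑' z, (A t).indicator (1 : (Fin k → ℤ) → ℝ≥0∞) z :=
        Summable.tsum_finsetSum fun _ _ => ENNReal.summable
    _ ≤ ∑ t ∈ T, cubeCount g 1 := Finset.sum_le_sum fun t _ => hA t
    _ = (2 * n + 1 : ℝ≥0∞) ^ k * cubeCount g 1 := by
        rw [Finset.sum_const, nsmul_eq_mul, hT]

/-- The number of points of a unimodular lattice in large cubes. -/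
theorem tendsto_cubeCount (g : SL(k, ℝ)) :
    Filter.Tendsto (fun n : ℕ => cubeCount g (n + 1 : ℕ) / ((n + 1 : ℕ) : ℝ≥0∞) ^ k) Filter.atTop
      (nhds (2 ^ k)) := by
  let φ : (Fin k → ℝ) → Fin k → ℝ := fun v => (g : Matrix (Fin k) (Fin k) ℝ) *ᵥ v
  let s : Set (Fin k → ℝ) := φ ⁻¹' Metric.closedBall 0 1
  have hφ : Continuous φ := by fun_prop
  have hlin : ∀ v, φ v = Matrix.toLin' (g : Matrix (Fin k) (Fin k) ℝ) v := fun v => by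
    rw [Matrix.toLin'_apply]
  have hclosed : IsClosed s := Metric.isClosed_closedBall.preimage hφ
  have hbdd : Bornology.IsBounded s := by
    let ψ : (Fin k → ℝ) → Fin k → ℝ :=
      fun v => ((g⁻¹ : SL(k, ℝ)) : Matrix (Fin k) (Fin k) ℝ) *ᵥ v
    have hψ : Continuous ψ := by fun_prop
    refine ((isCompact_closedBall (0 : Fin k → ℝ) 1).image hψ).isBounded.subset ?_
    intro v hv
    refine ⟨φ v, hv, ?_⟩
    simp only [φ, ψ, Matrix.mulVec_mulVec, ← Matrix.SpecialLinearGroup.coe_mul, inv_mul_cancel,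
      Matrix.SpecialLinearGroup.coe_one, Matrix.one_mulVec]
  have hconv : Convex ℝ s := by
    have : s = Matrix.toLin' (g : Matrix (Fin k) (Fin k) ℝ) ⁻¹' Metric.closedBall 0 1 := by
      ext v
      simp only [s, mem_preimage, hlin]
    rw [this]
    exact (convex_closedBall 0 1).linear_preimage _
  have hvol : volume.real s = 2 ^ k := by
    rw [Measure.real, (volume_preserving_mulVec g).measure_preimage
      Metric.isClosed_closedBall.measurableSet.nullMeasurableSet,
      Real.volume_pi_closedBall _ zero_le_one]
    simp
  -- Points of `g ℤ^k` in a cube of radius `n` correspond to points of `(1/n) ℤ^k` in the fixed set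
  -- `s = g⁻¹ [-1, 1]^k`, of volume `2 ^ k`. Convexity makes the boundary null.
  have hlim := tendsto_card_div_pow_atTop_volume s hbdd hclosed.measurableSet
    (hconv.addHaar_frontier volume)
  rw [hvol, Fintype.card_fin] at hlim
  have hlim' := ENNReal.tendsto_ofReal (hlim.comp (Filter.tendsto_add_atTop_nat 1))
  rw [show ENNReal.ofReal (2 ^ k) = 2 ^ k by
    rw [ENNReal.ofReal_pow zero_le_two]; norm_num] at hlim'
  refine hlim'.congr fun n => ?_
  have hn : (0 : ℝ) < ((n + 1 : ℕ) : ℝ) := by positivity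
  simp only [Function.comp_apply]
  rw [ENNReal.ofReal_div_of_pos (by positivity), ENNReal.ofReal_pow hn.le, ENNReal.ofReal_natCast,
    ENNReal.ofReal_natCast]
  congr 1
  let S : Set (Fin k → ℤ) :=
    {z | latticeMap g z ∈ Metric.closedBall (0 : Fin k → ℝ) ((n + 1 : ℕ) : ℝ)}
  have hmem : ∀ z : Fin k → ℤ,
      z ∈ S ↔ (((n + 1 : ℕ) : ℝ)⁻¹ • fun l => (z l : ℝ) : Fin k → ℝ) ∈ s := by
    intro z
    simp only [S, s, mem_preimage, mem_ofPred_eq, hlin, map_smul, mem_closedBall_zero_iff, norm_smul,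
      norm_inv, Real.norm_natCast]
    rw [inv_mul_le_iff₀ hn, mul_one, Matrix.toLin'_apply, latticeMap_apply]
  have hfin : S.Finite := by
    obtain ⟨R, hR⟩ := hbdd.subset_closedBall 0
    obtain ⟨N, hN⟩ := exists_nat_ge (((n + 1 : ℕ) : ℝ) * |R|)
    refine (Fintype.piFinset fun _ : Fin k => Finset.Icc (-(N : ℤ)) N).finite_toSet.subset ?_
    intro z hz
    simp only [Finset.mem_coe, Fintype.mem_piFinset, Finset.mem_Icc, ← abs_le]
    intro l
    have h1 := Metric.closedBall_subset_closedBall (le_abs_self R) (hR ((hmem z).1 hz))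
    have h2 := (mem_cube_iff (abs_nonneg R)).1 h1 l
    rw [Pi.smul_apply, smul_eq_mul, abs_mul, abs_of_pos (inv_pos.2 hn), inv_mul_le_iff₀ hn] at h2
    have h3 := h2.trans hN
    exact_mod_cast h3
  have hcount : cubeCount g (n + 1 : ℕ) = (Nat.card S : ℝ≥0∞) := by
    have h1 : cubeCount g (n + 1 : ℕ) = ∑' z, S.indicator (1 : (Fin k → ℤ) → ℝ≥0∞) z := rfl
    rw [h1, ← tsum_subtype]
    have := hfin.fintype
    rw [tsum_fintype]
    simp
  rw [hcount]
  congr 1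
  symm
  refine Nat.card_congr (Equiv.ofBijective (fun z : S =>
    (⟨((n + 1 : ℕ) : ℝ)⁻¹ • fun l => (z.1 l : ℝ), (hmem z.1).1 z.2, ?_⟩ :
      ↑(s ∩ (((n + 1 : ℕ) : ℝ)⁻¹ • (Submodule.span ℤ (range (Pi.basisFun ℝ (Fin k))) :
        Set (Fin k → ℝ)))))) ⟨?_, ?_⟩)
  · refine Set.smul_mem_smul_set ?_
    rw [SetLike.mem_coe, Module.Basis.mem_span_iff_repr_mem]
    intro l
    exact ⟨z.1 l, by simp⟩
  · intro z z' h
    have h1 := congrArg Subtype.val h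
    have h2 := smul_right_injective _ (inv_ne_zero hn.ne') h1
    apply Subtype.ext
    funext l
    exact_mod_cast congrFun h2 l
  · rintro ⟨v, hv, w, hw, rfl⟩
    rw [SetLike.mem_coe, Module.Basis.mem_span_iff_repr_mem] at hw
    choose z hz using hw
    have hz' : (fun l => (z l : ℝ)) = w := by
      funext l
      simpa using hz l
    refine ⟨⟨z, (hmem z).2 (by rw [hz']; exact hv)⟩, Subtype.ext ?_⟩
    simp only [hz']

end PointCount

/-! ### Evaluation of the covolume ratio by zeta values. -/

section ZetaConstant

/-- The value of the zeta function at an integer, as a sum in `[0, ∞]`. -/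
def zetaSum (k : ℕ) : ℝ≥0∞ := ∑' m : ℕ, ENNReal.ofReal (1 / ((m + 1 : ℕ) : ℝ) ^ k)

theorem summable_zetaSum {k : ℕ} (hk : 1 < k) :
    Summable fun m : ℕ => 1 / ((m + 1 : ℕ) : ℝ) ^ k :=
  (summable_nat_add_iff (f := fun n : ℕ => 1 / (n : ℝ) ^ k) 1).2
    (Real.summable_one_div_nat_pow.2 hk)

theorem zetaSum_ne_top {k : ℕ} (hk : 1 < k) : zetaSum k ≠ ∞ :=
  (summable_zetaSum hk).tsum_ofReal_ne_top

theorem riemannZeta_eq_zetaSum {k : ℕ} (hk : 1 < k) :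
    riemannZeta k = ((zetaSum k).toReal : ℂ) := by
  have h1 : (zetaSum k).toReal = ∑' m : ℕ, 1 / ((m + 1 : ℕ) : ℝ) ^ k := by
    rw [zetaSum, ← ENNReal.ofReal_tsum_of_nonneg (fun m => by positivity) (summable_zetaSum hk),
      ENNReal.toReal_ofReal (tsum_nonneg fun m => by positivity)]
  have h2 : ∑' n : ℕ, 1 / (n : ℝ) ^ k = ∑' m : ℕ, 1 / ((m + 1 : ℕ) : ℝ) ^ k := by
    rw [(Real.summable_one_div_nat_pow.2 hk).tsum_eq_zero_add]
    have hk0 : k ≠ 0 := by omega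
    simp [hk0]
  rw [zeta_nat_eq_tsum_of_gt_one hk, h1, ← h2]
  push_cast
  rfl

variable {e : ℕ}

/-- The indicator function of the tuples of length one that are mapped into a cube by scaling. -/
def cubeTest (e : ℕ) (R : ℝ) (m : ℕ) (v : Fin 1 → Fin (1 + e + 1) → ℝ) : ℝ≥0∞ :=
  (Metric.closedBall (0 : Fin (1 + e + 1) → ℝ) R).indicator 1 (((m + 1 : ℕ) : ℝ) • v 0)

theorem measurable_cubeTest (R : ℝ) (m : ℕ) : Measurable (cubeTest e R m) := by
  refine (measurable_one.indicator Metric.isClosed_closedBall.measurableSet).comp ?_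
  fun_prop

theorem lintegral_cubeTest {R : ℝ} (hR : 0 ≤ R) (m : ℕ) :
    ∫⁻ v, cubeTest e R m v =
      ENNReal.ofReal (2 * R) ^ (1 + e + 1) *
        ENNReal.ofReal (1 / ((m + 1 : ℕ) : ℝ) ^ (1 + e + 1)) := by
  have hB : MeasurableSet (Metric.closedBall (0 : Fin (1 + e + 1) → ℝ) R) :=
    Metric.isClosed_closedBall.measurableSet
  have hm : Measurable fun v : Fin (1 + e + 1) → ℝ =>
      (Metric.closedBall (0 : Fin (1 + e + 1) → ℝ) R).indicator (1 : (Fin (1 + e + 1) → ℝ) → ℝ≥0∞)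
        (((m + 1 : ℕ) : ℝ) • v) :=
    (measurable_one.indicator hB).comp (by fun_prop)
  have h1 := (volume_preserving_funUnique (Fin 1) (Fin (1 + e + 1) → ℝ)).lintegral_comp hm
  refine Eq.trans h1 ?_
  have h2 : (fun v : Fin (1 + e + 1) → ℝ =>
      (Metric.closedBall (0 : Fin (1 + e + 1) → ℝ) R).indicator (1 : (Fin (1 + e + 1) → ℝ) → ℝ≥0∞)
        (((m + 1 : ℕ) : ℝ) • v)) =
      ((fun v => ((m + 1 : ℕ) : ℝ) • v) ⁻¹'
        Metric.closedBall (0 : Fin (1 + e + 1) → ℝ) R).indicator 1 := rfl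
  have hpos : (0 : ℝ) < ((m + 1 : ℕ) : ℝ) := by positivity
  rw [h2, lintegral_indicator_one (by exact (measurable_const_smul _) hB),
    Measure.addHaar_preimage_smul _ hpos.ne', Real.volume_pi_closedBall _ hR, mul_comm,
    ENNReal.ofReal_pow (by positivity), Module.finrank_fin_fun, Fintype.card_fin,
    abs_of_pos (by positivity), one_div]

/-- The number of points of a lattice in the cube `[-R, R]^k`. -/
def latticeCubeCount (e : ℕ) (R : ℝ) (x : LatticeSpace (1 + e + 1)) : ℝ≥0∞ :=
  1 + ∑' m : ℕ, latticeTsum (cubeTest e R m) x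

theorem measurable_latticeCubeCount (R : ℝ) : Measurable (latticeCubeCount e R) :=
  measurable_const.add (Measurable.tsum fun m =>
    measurable_latticeTsum (measurable_cubeTest R m))

/-- The leading 1 counts the zero vector; each nonzero vector is `m + 1` times a primitive one for a
unique `m`. -/
theorem latticeCubeCount_toLattice {R : ℝ} (hR : 0 ≤ R) (g : SL(1 + e + 1, ℝ)) :
    latticeCubeCount e R (toLattice g) = cubeCount g R := by
  let F : (Fin (1 + e + 1) → ℤ) → ℝ≥0∞ := fun z =>
    (Metric.closedBall (0 : Fin (1 + e + 1) → ℝ) R).indicator 1 (latticeMap g z)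
  have h1 : cubeCount g R = F 0 + ∑' z : {z : Fin (1 + e + 1) → ℤ // z ≠ 0}, F z := by
    rw [cubeCount, ← ENNReal.summable.tsum_add_tsum_compl (s := {0}) ENNReal.summable,
      tsum_singleton (0 : Fin (1 + e + 1) → ℤ) F]
    rfl
  have h2 : F 0 = 1 := by
    simp only [F, map_zero]
    rw [indicator_of_mem (Metric.mem_closedBall_self hR)]
    rfl
  rw [h1, h2, latticeCubeCount, ← (Equiv.ofBijective _ (bijective_smul_primInt e)).tsum_eq,
    ENNReal.tsum_prod']
  congr 1
  refine tsum_congr fun m => ?_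
  rw [latticeTsum_toLattice]
  refine tsum_congr fun u => ?_
  simp only [cubeTest, F, Equiv.ofBijective_apply, applyInt_eq_latticeMap, map_smul]
  rw [← Int.cast_smul_eq_zsmul ℝ, Int.cast_natCast]

/-- By the mean value formula for `d = 1`, the vectors of content `m + 1` contribute a volume scaled
by `(m + 1) ^ (-k)`; these factors sum to `ζ(k)`. -/
theorem lintegral_latticeCubeCount {μ : Measure (LatticeSpace (1 + e + 1))}
    (hμ : IsNormalizedHaar μ) {R : ℝ} (hR : 0 ≤ R) :
    ∫⁻ x, latticeCubeCount e R x ∂μ = 1 + slCovolume (Fin.last e) / slCovolume (Fin.last (1 + e)) *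
      zetaSum (1 + e + 1) * ENNReal.ofReal (2 * R) ^ (1 + e + 1) := by
  have := hμ.isProbabilityMeasure
  simp only [latticeCubeCount]
  rw [lintegral_add_left measurable_const, lintegral_tsum fun m =>
    (measurable_latticeTsum (measurable_cubeTest R m)).aemeasurable]
  simp only [lintegral_latticeTsum hμ (measurable_cubeTest R _), lintegral_cubeTest hR,
    ENNReal.tsum_mul_left]
  rw [lintegral_one, measure_univ, zetaSum]
  ring

/-- The recursion for the covolume of `SL_k(ℤ)`. -/
theorem slCovolume_succ (e : ℕ) :
    slCovolume (Fin.last (1 + e)) = zetaSum (1 + e + 1) * slCovolume (Fin.last e) := by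
  obtain ⟨μ, hμ⟩ := exists_isNormalizedHaar (Fin.last (1 + e)) (slCovolume_ne_top (1 + e))
  have := hμ.isProbabilityMeasure
  obtain ⟨C, hC⟩ : ∃ C, C = slCovolume (Fin.last e) / slCovolume (Fin.last (1 + e)) *
    zetaSum (1 + e + 1) := ⟨_, rfl⟩
  have hCt : C ≠ ∞ := hC ▸ ENNReal.mul_ne_top
    (ENNReal.div_ne_top (slCovolume_ne_top e) (slCovolume_ne_zero _)) (zetaSum_ne_top (by omega))
  -- The normalised counts tend to `2 ^ k` pointwise, while their means tend to `C * 2 ^ k`; hence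
  -- `C = 1`. The factor 3 comes from `2(n + 1) + 1 ≤ 3(n + 1)`.
  have hlim := tendsto_lintegral_of_dominated_convergence (μ := μ)
    (F := fun n x => latticeCubeCount e (n + 1 : ℕ) x / ((n + 1 : ℕ) : ℝ≥0∞) ^ (1 + e + 1))
    (f := fun _ => 2 ^ (1 + e + 1)) (fun x => 3 ^ (1 + e + 1) * latticeCubeCount e 1 x)
    (fun n => (measurable_latticeCubeCount _).div_const _) (fun n => ?_) ?_ ?_
  · have h1 : ∀ n : ℕ, ∫⁻ x, latticeCubeCount e (n + 1 : ℕ) x / ((n + 1 : ℕ) : ℝ≥0∞) ^ (1 + e + 1) ∂μ =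
        (((n + 1 : ℕ) : ℝ≥0∞) ^ (1 + e + 1))⁻¹ + C * 2 ^ (1 + e + 1) := by
      intro n
      simp only [div_eq_mul_inv]
      rw [lintegral_mul_const _ (measurable_latticeCubeCount _),
        lintegral_latticeCubeCount hμ (Nat.cast_nonneg _), add_mul, one_mul,
        ENNReal.ofReal_mul zero_le_two, ENNReal.ofReal_natCast, mul_pow, ← hC,
        show ENNReal.ofReal 2 = 2 by norm_num]
      have h0 : ((n + 1 : ℕ) : ℝ≥0∞) ^ (1 + e + 1) ≠ 0 := pow_ne_zero _ (by positivity)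
      have ht : ((n + 1 : ℕ) : ℝ≥0∞) ^ (1 + e + 1) ≠ ∞ := ENNReal.pow_ne_top (ENNReal.natCast_ne_top _)
      rw [mul_assoc, mul_assoc, ENNReal.mul_inv_cancel h0 ht, mul_one]
    simp only [h1, lintegral_const, measure_univ, mul_one] at hlim
    have h2 : Filter.Tendsto (fun n : ℕ => (((n + 1 : ℕ) : ℝ≥0∞) ^ (1 + e + 1))⁻¹ + C * 2 ^ (1 + e + 1)) Filter.atTop
        (nhds (0 + C * 2 ^ (1 + e + 1))) := by
      refine Filter.Tendsto.add ?_ tendsto_const_nhds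
      refine tendsto_of_tendsto_of_tendsto_of_le_of_le tendsto_const_nhds
        ((ENNReal.tendsto_inv_nat_nhds_zero).comp (Filter.tendsto_add_atTop_nat 1))
        (fun _ => zero_le) fun n => ?_
      refine ENNReal.inv_le_inv.2 ?_
      exact le_self_pow₀ (by exact_mod_cast Nat.succ_le_succ (Nat.zero_le n)) (by omega)
    have h3 := tendsto_nhds_unique h2 hlim
    rw [zero_add] at h3
    have h4 : C = 1 := by
      have h5 : (2 : ℝ≥0∞) ^ (1 + e + 1) ≠ 0 := pow_ne_zero _ two_ne_zero
      have h6 : (2 : ℝ≥0∞) ^ (1 + e + 1) ≠ ∞ := ENNReal.pow_ne_top ENNReal.ofNat_ne_top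
      have h7 : C * 2 ^ (1 + e + 1) = 1 * 2 ^ (1 + e + 1) := by rw [h3, one_mul]
      exact (ENNReal.mul_left_inj h5 h6).1 h7
    rw [hC, div_eq_mul_inv, mul_right_comm, ← div_eq_mul_inv] at h4
    rw [ENNReal.div_eq_one_iff (slCovolume_ne_zero _) (slCovolume_ne_top _)] at h4
    rw [← h4, mul_comm]
  · refine Filter.Eventually.of_forall fun x => ?_
    obtain ⟨g, rfl⟩ := toLattice_surjective x
    simp only [latticeCubeCount_toLattice (Nat.cast_nonneg _),
      latticeCubeCount_toLattice zero_le_one]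
    refine ENNReal.div_le_of_le_mul ((cubeCount_le g _).trans ?_)
    rw [mul_right_comm, ← mul_pow]
    gcongr
    have h : 2 * (n + 1) + 1 ≤ 3 * (n + 1) := by omega
    exact_mod_cast h
  · rw [lintegral_const_mul _ (measurable_latticeCubeCount _),
      lintegral_latticeCubeCount hμ zero_le_one, ← hC]
    refine ENNReal.mul_ne_top (ENNReal.pow_ne_top ENNReal.ofNat_ne_top) ?_
    exact ENNReal.add_ne_top.2 ⟨ENNReal.one_ne_top,
      ENNReal.mul_ne_top hCt (ENNReal.pow_ne_top ENNReal.ofReal_ne_top)⟩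
  · refine Filter.Eventually.of_forall fun x => ?_
    obtain ⟨g, rfl⟩ := toLattice_surjective x
    simp only [latticeCubeCount_toLattice (Nat.cast_nonneg _)]
    exact tendsto_cubeCount g

theorem slCovolume_add (d e : ℕ) : slCovolume (Fin.last (d + e)) =
    (∏ i ∈ Finset.range d, zetaSum (d + e + 1 - i)) * slCovolume (Fin.last e) := by
  induction d generalizing e with
  | zero => rw [Finset.range_zero, Finset.prod_empty, one_mul, Nat.zero_add]
  | succ d ih =>
    have h1 := slCovolume_succ (d + e)
    rw [ih e] at h1
    have h2 : slCovolume (Fin.last (d + 1 + e)) = slCovolume (Fin.last (1 + (d + e))) := by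
      rw [show d + 1 + e = 1 + (d + e) by omega]
    rw [h2, h1, Finset.prod_range_succ', mul_comm _ (zetaSum _), mul_assoc]
    congr 1
    · congr 1; omega
    · congr 1
      refine Finset.prod_congr rfl fun i _ => ?_
      congr 1
      omega

end ZetaConstant

/-! ### The mean value formula for integrable functions. -/

section MeanValue

variable {d e : ℕ}

/-- The constant of the mean value formula. -/
def meanConst (d e : ℕ) : ℝ≥0∞ := slCovolume (Fin.last e) / slCovolume (Fin.last (d + e))

theorem meanConst_ne_top (d e : ℕ) : meanConst d e ≠ ∞ :=
  ENNReal.div_ne_top (slCovolume_ne_top e) (slCovolume_ne_zero _)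

theorem meanConst_eq (d e : ℕ) :
    meanConst d e = (∏ i ∈ Finset.range d, zetaSum (d + e + 1 - i))⁻¹ := by
  have h0 : slCovolume (Fin.last e) ≠ 0 := slCovolume_ne_zero _
  have ht : slCovolume (Fin.last e) ≠ ∞ := slCovolume_ne_top _
  rw [meanConst, slCovolume_add, div_eq_mul_inv, ENNReal.mul_inv (Or.inr ht) (Or.inr h0),
    mul_left_comm, ENNReal.mul_inv_cancel h0 ht, mul_one]

theorem toReal_meanConst (d e : ℕ) : (((meanConst d e).toReal : ℝ) : ℂ) =
    1 / ∏ i ∈ Finset.range d, riemannZeta (((d + e + 1 : ℕ) : ℂ) - (i : ℂ)) := by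
  have h1 : ∏ i ∈ Finset.range d, riemannZeta (((d + e + 1 : ℕ) : ℂ) - (i : ℂ)) =
      ∏ i ∈ Finset.range d, (((zetaSum (d + e + 1 - i)).toReal : ℝ) : ℂ) := by
    refine Finset.prod_congr rfl fun i hi => ?_
    have hi' := Finset.mem_range.1 hi
    rw [← riemannZeta_eq_zetaSum (by omega), Nat.cast_sub (by omega)]
  rw [h1, meanConst_eq, ENNReal.toReal_inv, ENNReal.toReal_prod, one_div]
  push_cast
  rfl

variable {μ : Measure (LatticeSpace (d + e + 1))}

/-- The mean value formula for the indicator of a measurable null set containing `E` gives a sum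
that vanishes almost everywhere. This permits replacing an integrable function by a measurable
representative. -/
theorem ae_forall_notMem_of_null (hμ : IsNormalizedHaar μ) {E : Set (Fin d → Fin (d + e + 1) → ℝ)}
    (hE : volume E = 0) : ∀ᵐ x ∂μ, ∀ v ∈ primitiveTuples d x.lattice, v ∉ E := by
  have hm := measurableSet_toMeasurable volume E
  have hf : Measurable ((toMeasurable volume E).indicator
      (1 : (Fin d → Fin (d + e + 1) → ℝ) → ℝ≥0∞)) :=
    measurable_one.indicator hm
  have h1 := lintegral_latticeTsum hμ hf
  rw [lintegral_indicator_one hm, measure_toMeasurable, hE, mul_zero,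
    lintegral_eq_zero_iff (measurable_latticeTsum hf)] at h1
  filter_upwards [h1] with x hx v hv hvE
  have h2 := ENNReal.tsum_eq_zero.1 hx ⟨v, hv⟩
  rw [indicator_of_mem (subset_toMeasurable _ _ hvE)] at h2
  exact one_ne_zero h2

theorem lintegral_latticeTsum_ne_top (hμ : IsNormalizedHaar μ)
    {f : (Fin d → Fin (d + e + 1) → ℝ) → ℝ≥0∞} (hf : Measurable f) (hfin : ∫⁻ v, f v ≠ ∞) :
    ∫⁻ x, latticeTsum f x ∂μ ≠ ∞ := by
  rw [lintegral_latticeTsum hμ hf]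
  exact ENNReal.mul_ne_top (meanConst_ne_top d e) hfin

/-- The mean value formula for real functions. -/
theorem real_mean_value (hμ : IsNormalizedHaar μ) {ψ : (Fin d → Fin (d + e + 1) → ℝ) → ℝ}
    (hm : Measurable ψ) (hψ : Integrable ψ) :
    ∃ S : LatticeSpace (d + e + 1) → ℝ, Integrable S μ ∧
      (∀ᵐ x ∂μ, HasSum (fun v : primitiveTuples d x.lattice => ψ v) (S x)) ∧
      ∫ x, S x ∂μ = (meanConst d e).toReal * ∫ v, ψ v := by
  -- Applied to `ψ` and `-ψ`, this treats the positive and negative parts separately.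
  have key : ∀ χ : (Fin d → Fin (d + e + 1) → ℝ) → ℝ, Measurable χ → Integrable χ →
      Integrable (fun x => (latticeTsum (fun v => ENNReal.ofReal (χ v)) x).toReal) μ ∧
      (∀ᵐ x ∂μ, HasSum (fun v : primitiveTuples d x.lattice => (ENNReal.ofReal (χ v)).toReal)
        (latticeTsum (fun v => ENNReal.ofReal (χ v)) x).toReal) ∧
      ∫ x, (latticeTsum (fun v => ENNReal.ofReal (χ v)) x).toReal ∂μ =
        (meanConst d e).toReal * (∫⁻ v, ENNReal.ofReal (χ v)).toReal := by
    intro χ hχm hχ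
    have hfin : ∫⁻ v, ENNReal.ofReal (χ v) ≠ ∞ := hχ.lintegral_lt_top.ne
    have hmp : Measurable fun v => ENNReal.ofReal (χ v) := hχm.ennreal_ofReal
    have hne := lintegral_latticeTsum_ne_top hμ hmp hfin
    have hml := measurable_latticeTsum hmp
    have hlt := ae_lt_top hml hne
    refine ⟨integrable_toReal_of_lintegral_ne_top hml.aemeasurable hne, ?_, ?_⟩
    · filter_upwards [hlt] with x hx
      have h1 := ENNReal.hasSum_toReal (f := fun v : primitiveTuples d x.lattice =>
        ENNReal.ofReal (χ v)) hx.ne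
      rwa [← ENNReal.tsum_toReal_eq fun _ => ENNReal.ofReal_ne_top] at h1
    · rw [integral_toReal hml.aemeasurable hlt, lintegral_latticeTsum hμ hmp, ENNReal.toReal_mul]
      rfl
  obtain ⟨h1, h2, h3⟩ := key ψ hm hψ
  obtain ⟨h1', h2', h3'⟩ := key (fun v => -ψ v) hm.neg hψ.neg
  refine ⟨_, h1.sub h1', ?_, ?_⟩
  · filter_upwards [h2, h2'] with x hx hx'
    have h4 := hx.sub hx'
    have h5 : (fun v : primitiveTuples d x.lattice => ψ v) = fun v : primitiveTuples d x.lattice =>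
        (ENNReal.ofReal (ψ v)).toReal - (ENNReal.ofReal (-ψ v)).toReal := by
      funext v
      rw [ENNReal.toReal_ofReal', ENNReal.toReal_ofReal', max_zero_sub_max_neg_zero_eq_self]
    rw [h5]
    exact h4
  · simp only [Pi.sub_apply]
    rw [integral_sub h1 h1', h3, h3', ← mul_sub,
      ← integral_eq_lintegral_pos_part_sub_lintegral_neg_part hψ]

/-- The mean value formula for measurable complex functions. -/
theorem complex_mean_value (hμ : IsNormalizedHaar μ) {φ : (Fin d → Fin (d + e + 1) → ℝ) → ℂ}
    (hm : Measurable φ) (hφ : Integrable φ) :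
    ∃ S : LatticeSpace (d + e + 1) → ℂ, Integrable S μ ∧
      (∀ᵐ x ∂μ, HasSum (fun v : primitiveTuples d x.lattice => φ v) (S x)) ∧
      ∫ x, S x ∂μ = (meanConst d e).toReal * ∫ v, φ v := by
  obtain ⟨S, hS1, hS2, hS3⟩ := real_mean_value hμ (Complex.measurable_re.comp hm) hφ.re
  obtain ⟨T, hT1, hT2, hT3⟩ := real_mean_value hμ (Complex.measurable_im.comp hm) hφ.im
  have hSc : Integrable (fun x => (S x : ℂ)) μ := hS1.ofReal
  have hTc : Integrable (fun x => (T x : ℂ) * Complex.I) μ := hT1.ofReal.mul_const _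
  refine ⟨fun x => (S x : ℂ) + (T x : ℂ) * Complex.I, hSc.add hTc, ?_, ?_⟩
  · filter_upwards [hS2, hT2] with x hx hx'
    rw [Complex.hasSum_iff]
    refine ⟨?_, ?_⟩
    · simpa using hx
    · simpa using hx'
  · rw [integral_add hSc hTc, integral_mul_const, integral_complex_ofReal, integral_complex_ofReal,
      hS3, hT3]
    have h := integral_re_add_im (𝕜 := ℂ) hφ
    rw [← h]
    simp only [Function.comp_apply, RCLike.re_to_complex, RCLike.im_to_complex,
      Complex.coe_algebraMap, RCLike.I_to_complex]
    push_cast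
    ring

end MeanValue

end

theorem theorem7p3 (k d : ℕ) (hd : 1 ≤ d) (hdk : d < k) :
    (∃ μ : Measure (LatticeSpace k), IsNormalizedHaar μ) ∧
    ∀ μ : Measure (LatticeSpace k), IsNormalizedHaar μ →
      ∀ φ : (Fin d → Fin k → ℝ) → ℂ, Integrable φ volume →
        (∀ᵐ x ∂μ, Summable fun v : primitiveTuples d x.lattice => φ v) ∧
        Integrable (primitiveSum φ) μ ∧
        ∫ x, primitiveSum φ x ∂μ =
          (1 / ∏ i ∈ Finset.range d, riemannZeta ((k : ℂ) - (i : ℂ))) * ∫ v, φ v := by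
  -- With `k = d + e + 1` the complementary block has size `e + 1 ≥ 1`, and the zeta arguments `k -
  -- i`, `i < d`, are at least 2.
  obtain ⟨e, rfl⟩ := Nat.exists_eq_add_of_lt hdk
  refine ⟨exists_isNormalizedHaar (Fin.last (d + e)) (slCovolume_ne_top _), fun μ hμ φ hφ => ?_⟩
  obtain ⟨φ', hφ'm, hφ'⟩ := hφ.1
  obtain ⟨S, hS1, hS2, hS3⟩ := complex_mean_value hμ hφ'm.measurable (hφ.congr hφ')
  have hsum : ∀ᵐ x ∂μ, HasSum (fun v : primitiveTuples d x.lattice => φ v) (S x) := by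
    filter_upwards [hS2, ae_forall_notMem_of_null hμ hφ'] with x hx hE
    convert hx using 1
    funext v
    exact not_not.1 (hE v.1 v.2)
  have hae : primitiveSum φ =ᵐ[μ] S := by
    filter_upwards [hsum] with x hx
    exact hx.tsum_eq
  -- In `ℂ` unconditional summability is the same as absolute convergence.
  refine ⟨hsum.mono fun x hx => hx.summable, hS1.congr hae.symm, ?_⟩
  rw [integral_congr_ae hae, hS3, toReal_meanConst, integral_congr_ae hφ']
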